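/- A continuum is a nonempty compact connected metric space. An arc is a homeomorphic copy of $I=[0,1]$; its endpoints are the two points whose removal leaves it connected. A simple triod is a homeomorphic copy of $([-1,1]\times\{0\})\cup(\{0\}\times[0,1])$, its top being the point corresponding to the origin. A dendroid is a continuum that is arcwise connected and hereditarily unicoherent (whenever $A$, $B$ and $A\cup B$ are subcontinua, $A\cap B$ is connected). In a dendroid, $[x,y]$ denotes the unique arc with endpoints $x\neq y$, and $[x,x]=\{x\}$. A fan is a dendroid $F$ for which exactly one point $t$, the top of $F$, is the top of a simple triod contained in $F$. The set $E(F)$ of endpoints of $F$ consists of the points of $F$ that are an endpoint of every arc in $F$ containing them, and the blades of $F$ are the arcs $[t,e]$ with $e\in E(F)$. The fan $F$ is smooth if $x_n\to x$ in $F$ implies $[t,x_n]\to[t,x]$ in the Hausdorff metric. It is endpoint-homogeneous if for all $e,e'\in E(F)$ there is a homeomorphism $h:F\to F$ with $h(e)=e'$. For $X\subseteq[0,1]$, the fan $F$ is $X$-EPG ($X$-endpoint generated) if for every blade $B$ of $F$ there is a homeomorphism $\varphi:[0,1]\to B$ with $\varphi(0)=t$ and $\varphi[X]=B\cap\overline{E(F)\setminus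 B}$. **Theorem.** Let $X$ be a closed subset of $[0,1]$ with $1\notin X$, and suppose that $X=\emptyset$ or $0\in X$. Then there is an endpoint-homogeneous, $X$-EPG smooth fan. -/

import Mathlib

open Set Filter Topology

namespace EPGFan

section Continua

variable {X : Type*} [MetricSpace X]

/-- A subcontinuum of a metric space: a nonempty, compact, connected subset.
(`IsConnected` includes non-emptiness.) -/
def IsSubcontinuum (A : Set X) : Prop :=
  IsCompact A ∧ IsConnected A

/-- An arc: a subset homeomorphic to the unit interval. -/
def IsArc (A : Set X) : Prop :=
  Nonempty (unitInterval ≃ₜ A)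

/-- The endpoints of an arc `A`: the points `a ∈ A` such that `A \ {a}` is connected. -/
def arcEndpoints (A : Set X) : Set X :=
  {a | a ∈ A ∧ IsConnected (A \ {a})}

/-- `A` is an arc whose set of endpoints is `{x, y}`. -/
def IsArcBetween (A : Set X) (x y : X) : Prop :=
  IsArc A ∧ arcEndpoints A = {x, y}

/-- The arc `[x, y]`, with `[x, x] = {x}`. In a dendroid there is exactly one arc with endpoints
`x ≠ y`, and this set is that arc; there is no arc with `x = y` as its only endpoint, so that
`segment x x = {x}`. -/
def segment (x y : X) : Set X :=
  {x, y} ∪ ⋃₀ {A : Set X | IsArcBetween A x y}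

/-- A set `Y` is unicoherent if any two subcontinua with union `Y` have connected
intersection. -/
def IsUnicoherent (Y : Set X) : Prop :=
  ∀ A B : Set X, IsSubcontinuum A → IsSubcontinuum B → Y = A ∪ B → IsConnected (A ∩ B)

/-- The simple triod `([-1,1] × {0}) ∪ ({0} × [0,1])` in the plane. -/
def simpleTriod : Set (ℝ × ℝ) :=
  Icc (-1) 1 ×ˢ {0} ∪ {0} ×ˢ Icc 0 1

/-- The top of the simple triod: the origin, i.e. the only point whose removal leaves three
connected components. -/
def triodTop : simpleTriod :=
  ⟨(0, 0), Or.inl ⟨⟨by norm_num, by norm_num⟩, rfl⟩⟩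

end Continua

section Fans

variable (X : Type*) [MetricSpace X]

/-- A continuum is a nonempty, compact, connected metric space. -/
def IsContinuum : Prop :=
  CompactSpace X ∧ ConnectedSpace X

/-- Any two distinct points are the endpoints of an arc. -/
def ArcwiseConnected : Prop :=
  ∀ x y : X, x ≠ y → ∃ A : Set X, IsArcBetween A x y

/-- Every subcontinuum is unicoherent. -/
def HereditarilyUnicoherent : Prop :=
  ∀ Y : Set X, IsSubcontinuum Y → IsUnicoherent Y

/-- A dendroid: an arcwise connected, hereditarily unicoherent continuum. -/
def IsDendroid : Prop :=
  IsContinuum X ∧ ArcwiseConnected X ∧ HereditarilyUnicoherent X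

/-- `E(X)`: the points that are an endpoint of every arc containing them. -/
def endpoints : Set X :=
  {x | ∀ A : Set X, IsArc A → x ∈ A → x ∈ arcEndpoints A}

/-- `R(X)`: the points that are the top of some simple triod contained in `X`. -/
def ramificationPoints : Set X :=
  {x | ∃ (T : Set X) (φ : simpleTriod ≃ₜ T), (φ triodTop : X) = x}

/-- A fan with top `t`: a dendroid whose only ramification point is `t`. -/
def IsFan (t : X) : Prop :=
  IsDendroid X ∧ ramificationPoints X = {t}

/-- The blades `[t, e]`, `e ∈ E(X)`, of a fan with top `t`. -/
def blades (t : X) : Set (Set X) :=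
  {B | ∃ e ∈ endpoints X, B = segment t e}

/-- A fan with top `t` is smooth if `xₙ → x` implies `[t, xₙ] → [t, x]` with respect to the
Hausdorff distance. -/
def IsSmooth (t : X) : Prop :=
  ∀ (x : ℕ → X) (a : X), Tendsto x atTop (𝓝 a) →
    Tendsto (fun n => Metric.hausdorffEDist (segment t (x n)) (segment t a)) atTop (𝓝 0)

/-- Any endpoint is mapped to any other endpoint by some self-homeomorphism. -/
def EndpointHomogeneous : Prop :=
  ∀ e ∈ endpoints X, ∀ e' ∈ endpoints X, ∃ h : X ≃ₜ X, h e = e'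

/-- A fan with top `t` is `S`-endpoint generated, for `S ⊆ [0,1]`, if every blade `B` has a
parametrization `φ : [0,1] ≃ B` with `φ 0 = t` that maps `S` onto `B ∩ closure (E \ B)`. -/
def IsEndpointGenerated (t : X) (S : Set unitInterval) : Prop :=
  ∀ B ∈ blades X t, ∃ φ : unitInterval ≃ₜ B, (φ 0 : X) = t ∧
    (fun s => (φ s : X)) '' S = B ∩ closure (endpoints X \ B)

end Fans

end EPGFan

/-! Fans are built in a product of lines as unions of segments issuing from the origin. If every
coordinate of a point is 0 or equals a distinguished height coordinate, then the set of nonvanishing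
coordinates records a direction, and directions vary in a zero-dimensional space. In a compact star
of this kind (`IsStarChart`) connected sets missing the centre lie in one direction, and a
subcontinuum containing the centre contains the rays to its points (`ray_subset`). Hence the star is
a dendroid without ramification points off the centre. It is smooth because scaling by factors in
[0,1] does not increase distances, and once two directions exist its endpoints are the tips of its
maximal rays.

If X is empty, three segments suffice. If 0 ∈ X, take positive numbers x_i, bounded by some r < 1,
with cluster set X (`exists_seq_cluster`). The blades are indexed by the reduced words over ℕ, that
is, by the free product of countably many groups of order two. The empty word has length L = 1, and
L(iw) = x_i L(w)^(i+1). A point at height y on blade w has coordinate y at the prefixes of w and 0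
elsewhere, so the directions of the blades wiv tend to that of w as i → ∞.

Left multiplication by the letter i, combined with s ↦ x_i s^(i+1) or its inverse on heights, is an
involutive homeomorphism (`flip`). These maps fix the top and generate a group transitive on tips
(`exists_homeomorph_tip`). This gives endpoint-homogeneity and reduces endpoint generation to the
root blade. There the tips of one-letter blades have heights x_i, clustering exactly at X. The tip
of iv with v nonempty has height at most r^(i+1), so such tips can cluster on the root blade only at
the top, which belongs to X already (`mem_closure_tips`). -/

namespace EPGFan

/-! ### Arcs and their endpoints. -/

section Arcs

variable {X : Type*} [MetricSpace X]

theorem isConnected_compl_singleton_unitInterval_iff (s : unitInterval) :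
    IsConnected ({s}ᶜ : Set unitInterval) ↔ s = 0 ∨ s = 1 := by
  constructor
  · rintro ⟨-, h⟩
    by_contra! hs
    have h0 : (0 : unitInterval) ∈ ({s}ᶜ : Set unitInterval) := fun h => hs.1 h.symm
    have h1 : (1 : unitInterval) ∈ ({s}ᶜ : Set unitInterval) := fun h => hs.2 h.symm
    exact h.ordConnected.out h0 h1 ⟨s.2.1, s.2.2⟩ rfl
  · rintro (rfl | rfl)
    · refine ⟨⟨1, by simp⟩, Set.OrdConnected.isPreconnected ⟨?_⟩⟩
      intro x hx y hy z hz hz0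
      rw [mem_singleton_iff] at hz0
      subst hz0
      exact hx (le_antisymm hz.1 x.2.1)
    · refine ⟨⟨0, by simp⟩, Set.OrdConnected.isPreconnected ⟨?_⟩⟩
      intro x hx y hy z hz hz0
      rw [mem_singleton_iff] at hz0
      subst hz0
      exact hy (le_antisymm y.2.2 hz.2)

theorem arcEndpoints_eq {A : Set X} (φ : unitInterval ≃ₜ A) :
    arcEndpoints A = {(φ 0 : X), (φ 1 : X)} := by
  have key : ∀ s : unitInterval, IsConnected (A \ {(φ s : X)}) ↔ s = 0 ∨ s = 1 := by
    intro s
    have hA : A \ {(φ s : X)} = (fun r => (φ r : X)) '' {s}ᶜ := by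
      ext a
      constructor
      · rintro ⟨ha, hs⟩
        refine ⟨φ.symm ⟨a, ha⟩, fun h => hs ?_, by simp⟩
        rw [mem_singleton_iff] at h
        simp [← h]
      · rintro ⟨r, hr, rfl⟩
        exact ⟨(φ r).2, fun h => hr (φ.injective (Subtype.ext h))⟩
    have hind : IsInducing (fun r => (φ r : X)) :=
      IsInducing.subtypeVal.comp φ.isInducing
    rw [hA, ← isConnected_compl_singleton_unitInterval_iff, IsConnected, IsConnected,
      hind.isPreconnected_image, image_nonempty]
  ext a
  constructor
  · rintro ⟨ha, hc⟩
    have h : (φ (φ.symm ⟨a, ha⟩) : X) = a := by simp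
    rw [← h, key] at hc
    rcases hc with hc | hc
    · left; rw [← hc]; exact h.symm
    · right; rw [mem_singleton_iff, ← hc]; exact h.symm
  · rintro (rfl | rfl)
    · exact ⟨(φ 0).2, (key 0).2 (Or.inl rfl)⟩
    · exact ⟨(φ 1).2, (key 1).2 (Or.inr rfl)⟩

theorem IsArc.isSubcontinuum {A : Set X} (hA : IsArc A) : IsSubcontinuum A := by
  obtain ⟨φ⟩ := hA
  have h : A = range (fun r => (φ r : X)) := by
    ext a
    constructor
    · intro ha
      exact ⟨φ.symm ⟨a, ha⟩, by simp⟩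
    · rintro ⟨r, rfl⟩
      exact (φ r).2
  have hc : Continuous (fun r => (φ r : X)) := continuous_subtype_val.comp φ.continuous
  rw [h]
  exact ⟨isCompact_range hc, isConnected_range hc⟩

theorem IsArcBetween.left_mem {A : Set X} {x y : X} (h : IsArcBetween A x y) : x ∈ A := by
  have : x ∈ arcEndpoints A := by rw [h.2]; simp
  exact this.1

theorem IsArcBetween.right_mem {A : Set X} {x y : X} (h : IsArcBetween A x y) : y ∈ A := by
  have : y ∈ arcEndpoints A := by rw [h.2]; simp
  exact this.1

theorem IsArcBetween.symm {A : Set X} {x y : X} (h : IsArcBetween A x y) :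
    IsArcBetween A y x := ⟨h.1, by rw [h.2, pair_comm]⟩

theorem IsArcBetween.ne {A : Set X} {x y : X} (h : IsArcBetween A x y) : x ≠ y := by
  rintro rfl
  obtain ⟨⟨φ⟩, h2⟩ := h
  rw [arcEndpoints_eq φ, pair_eq_singleton] at h2
  have h0 : (φ 0 : X) ∈ ({x} : Set X) := h2 ▸ by simp
  have h1 : (φ 1 : X) ∈ ({x} : Set X) := h2 ▸ by simp
  exact zero_ne_one (φ.injective (Subtype.ext (h0.trans h1.symm)))

/-- A connected subset of an arc containing both endpoints is the whole arc. -/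
theorem IsArcBetween.eq_of_subset {A C : Set X} {x y : X} (h : IsArcBetween A x y)
    (hC : IsPreconnected C) (hx : x ∈ C) (hy : y ∈ C) (hCA : C ⊆ A) : C = A := by
  have hne := h.ne
  obtain ⟨⟨φ⟩, h2⟩ := h
  refine hCA.antisymm fun a ha => ?_
  have hends : (φ 0 : X) ∈ C ∧ (φ 1 : X) ∈ C := by
    have e : arcEndpoints A ⊆ C := by
      rw [h2]; rintro z (rfl | rfl) <;> assumption
    rw [arcEndpoints_eq φ] at e
    exact ⟨e (by simp), e (by simp)⟩
  have hind : IsInducing (fun r => (φ r : X)) := IsInducing.subtypeVal.comp φ.isInducing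
  have hpre : IsPreconnected ((fun r => (φ r : X)) ⁻¹' C) := by
    rw [← hind.isPreconnected_image, image_preimage_eq_of_subset]
    · exact hC
    · intro c hc
      exact ⟨φ.symm ⟨c, hCA hc⟩, by simp⟩
  have := hpre.ordConnected.out hends.1 hends.2 ⟨(φ.symm ⟨a, ha⟩).2.1, (φ.symm ⟨a, ha⟩).2.2⟩
  simpa using this

theorem isArcBetween_image {a b : ℝ} (hab : a < b) {γ : ℝ → X}
    (hc : ContinuousOn γ (Icc a b)) (hi : InjOn γ (Icc a b)) :
    IsArcBetween (γ '' Icc a b) (γ a) (γ b) := by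
  let f : Icc a b → γ '' Icc a b := fun s => ⟨γ s, mem_image_of_mem γ s.2⟩
  have hf : Continuous f := Continuous.subtype_mk hc.domRestrict _
  have hbij : Function.Bijective f := by
    constructor
    · intro s s' h
      exact Subtype.ext (hi s.2 s'.2 (congrArg Subtype.val h))
    · rintro ⟨_, s, hs, rfl⟩
      exact ⟨⟨s, hs⟩, rfl⟩
  let e : Icc a b ≃ₜ γ '' Icc a b :=
    Continuous.homeoOfEquivCompactToT2 (f := Equiv.ofBijective f hbij) hf
  let φ : unitInterval ≃ₜ γ '' Icc a b := (iccHomeoI a b hab).symm.trans e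
  refine ⟨⟨φ⟩, ?_⟩
  rw [arcEndpoints_eq φ]
  have h0 : (φ 0 : X) = γ a := by
    change γ ((iccHomeoI a b hab).symm 0) = γ a
    simp
  have h1 : (φ 1 : X) = γ b := by
    change γ ((iccHomeoI a b hab).symm 1) = γ b
    simp
  rw [h0, h1]

end Arcs

end EPGFan

namespace EPGFan

/-! ### Stars with two-valued coordinates: rays, connected subsets and arcs. -/

section Rays

variable {X ι : Type*} {c : X → ι → ℝ}

/-- The straight segment from the centre of a star to `x`. -/
def ray (c : X → ι → ℝ) (x : X) : Set X :=
  {z | ∃ s : ℝ, 0 ≤ s ∧ s ≤ 1 ∧ c z = s • c x}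

theorem mem_ray_self (c : X → ι → ℝ) (x : X) : x ∈ ray c x :=
  ⟨1, zero_le_one, le_rfl, by simp⟩

/-- `e` is the outer end of a ray of positive length. -/
def IsTip (c : X → ι → ℝ) (t e : X) : Prop :=
  e ≠ t ∧ ∀ x, e ∈ ray c x → x = e

theorem notMem_ray_of_isTip {t a b : X} (ha : IsTip c t a) (hab : a ≠ b) : a ∉ ray c b :=
  fun h => hab (ha.2 b h).symm

end Rays

section Stars

variable {X ι : Type*} [MetricSpace X]

/-- Coordinates `c` on a metric space `X` that exhibit it as a star with centre `t`: it is closed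
under scaling by factors in `[0,1]`, and every coordinate of a point either vanishes or equals
the height `c x o`, so that the directions form a zero-dimensional space. -/
structure IsStarChart (c : X → ι → ℝ) (o : ι) (t : X) : Prop where
  continuous : Continuous c
  injective : Function.Injective c
  nonneg : ∀ x, 0 ≤ c x o
  eq_or_eq : ∀ x u, c x u = 0 ∨ c x u = c x o
  top : c t = 0
  exists_smul : ∀ x (s : ℝ), 0 ≤ s → s ≤ 1 → ∃ y, c y = s • c x
  edist_le : ∀ (s : ℝ) x y x' y', 0 ≤ s → s ≤ 1 → c x' = s • c x → c y' = s • c y →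
    edist x' y' ≤ edist x y

namespace IsStarChart

variable {c : X → ι → ℝ} {o : ι} {t : X}

theorem eq_top_iff (h : IsStarChart c o t) {x : X} : x = t ↔ c x o = 0 := by
  constructor
  · rintro rfl
    simp [h.top]
  · intro hx
    apply h.injective
    rw [h.top]
    ext u
    rcases h.eq_or_eq x u with hu | hu
    · exact hu
    · exact hu.trans hx

theorem pos (h : IsStarChart c o t) {x : X} (hx : x ≠ t) : 0 < c x o :=
  lt_of_le_of_ne (h.nonneg x) fun h0 => hx (h.eq_top_iff.2 h0.symm)

theorem top_mem_ray (h : IsStarChart c o t) (x : X) : t ∈ ray c x :=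
  ⟨0, le_rfl, zero_le_one, by simp [h.top]⟩

theorem ray_top (h : IsStarChart c o t) : ray c t = {t} := by
  ext z
  constructor
  · rintro ⟨s, -, -, hs⟩
    rw [h.top, smul_zero, ← h.top] at hs
    exact h.injective hs
  · rintro rfl
    exact mem_ray_self c z

theorem le_of_mem_ray (h : IsStarChart c o t) {x z : X} (hz : z ∈ ray c x) :
    c z o ≤ c x o := by
  obtain ⟨s, h0, h1, hs⟩ := hz
  rw [hs]
  exact mul_le_of_le_one_left (h.nonneg x) h1

theorem eq_of_mem_ray (h : IsStarChart c o t) {x y z : X} (hy : y ∈ ray c x) (hz : z ∈ ray c x)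
    (hyz : c y o = c z o) : y = z := by
  by_cases hx : x = t
  · subst hx
    rw [h.ray_top] at hy hz
    exact hy.trans hz.symm
  · obtain ⟨s, h0, h1, hs⟩ := hy
    obtain ⟨s', h0', h1', hs'⟩ := hz
    have e : s * c x o = s' * c x o := by
      have := hyz
      rwa [hs, hs'] at this
    have : s = s' := mul_right_cancel₀ (h.pos hx).ne' e
    subst this
    exact h.injective (hs.trans hs'.symm)

/-- Two points on the same side of the centre, in the same direction, are comparable. -/
theorem mem_ray_of_forall (h : IsStarChart c o t) {x y : X} (hx : x ≠ t)
    (hxy : ∀ u, c x u = 0 ↔ c y u = 0) (hle : c y o ≤ c x o) : y ∈ ray c x := by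
  have hp := h.pos hx
  refine ⟨c y o / c x o, div_nonneg (h.nonneg y) hp.le, div_le_one_of_le₀ hle hp.le, ?_⟩
  ext u
  rw [Pi.smul_apply, smul_eq_mul]
  rcases h.eq_or_eq x u with hu | hu
  · rw [hu, mul_zero]
    exact (hxy u).1 hu
  · rw [hu, div_mul_cancel₀ _ hp.ne']
    rcases h.eq_or_eq y u with hv | hv
    · exact absurd (hu.symm.trans ((hxy u).2 hv)) hp.ne'
    · exact hv

/-- A common point off the centre would give `x` and `y` the same vanishing coordinates, making them
comparable by height. Thus incomparable rays meet only in the centre. -/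
theorem eq_zero_of_smul_eq_smul (h : IsStarChart c o t) {x y : X} (hxy : x ∉ ray c y)
    (hyx : y ∉ ray c x) {s r : ℝ} (e : s • c x = r • c y) : s = 0 := by
  have hxt : x ≠ t := fun e => hxy (e ▸ h.top_mem_ray y)
  have hyt : y ≠ t := fun e => hyx (e ▸ h.top_mem_ray x)
  by_contra hs
  have e0 : s * c x o = r * c y o := congrFun e o
  have hr : r ≠ 0 := by
    rintro rfl
    rw [zero_mul, mul_eq_zero] at e0
    exact e0.elim hs (h.pos hxt).ne'
  have hu : ∀ u, c x u = 0 ↔ c y u = 0 := by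
    intro u
    have eu : s * c x u = r * c y u := congrFun e u
    constructor
    · intro hu
      rw [hu, mul_zero, eq_comm, mul_eq_zero] at eu
      exact eu.resolve_left hr
    · intro hu
      rw [hu, mul_zero, mul_eq_zero] at eu
      exact eu.resolve_left hs
  rcases le_total (c y o) (c x o) with hle | hle
  · exact hyx (h.mem_ray_of_forall hxt hu hle)
  · exact hxy (h.mem_ray_of_forall hyt (fun u => (hu u).symm) hle)

theorem continuous_apply (h : IsStarChart c o t) (u : ι) : Continuous fun x => c x u :=
  (_root_.continuous_apply u).comp h.continuous

/-- A subcontinuum containing the centre contains the rays to all of its points. -/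
theorem ray_subset (h : IsStarChart c o t) {A : Set X} (hA : IsSubcontinuum A) (ht : t ∈ A)
    {x : X} (hx : x ∈ A) : ray c x ⊆ A := by
  intro z hz
  by_contra hzA
  have hzt : z ≠ t := fun e => hzA (e ▸ ht)
  have hzx : c z o < c x o := by
    refine lt_of_le_of_ne (h.le_of_mem_ray hz) fun e => hzA ?_
    rwa [h.eq_of_mem_ray hz (mem_ray_self c x) e]
  have hxt : x ≠ t := by
    rintro rfl
    rw [h.ray_top] at hz
    exact hzt hz
  have hz0 := h.pos hzt
  have hK : IsClosed (c '' (A ∩ {a | c a o = c z o})) :=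
    ((hA.1.inter_right (isClosed_eq (h.continuous_apply o) continuous_const)).image
      h.continuous).isClosed
  have hzK : c z ∈ (c '' (A ∩ {a | c a o = c z o}))ᶜ := by
    rintro ⟨a, ha, e⟩
    exact hzA (h.injective e ▸ ha.1)
  obtain ⟨I, U, hU, hsub⟩ := isOpen_pi_iff.1 hK.isOpen_compl _ hzK
  -- Both sets describe the points above `z` whose direction agrees with that of `z` on `I`, once by
  -- strict inequalities and once by equalities. They turn out to have the same trace on `A`, which
  -- is therefore clopen in `A` and separates `x` from `t`.
  let O : Set X := {a | c z o < c a o} ∩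
    ⋂ u ∈ I, {a | (c z u = 0 → c a u < c a o) ∧ (c z u ≠ 0 → 0 < c a u)}
  let D : Set X := {a | c z o ≤ c a o} ∩
    ⋂ u ∈ I, {a | (c z u = 0 → c a u = 0) ∧ (c z u ≠ 0 → c a u = c a o)}
  have hO : IsOpen O := by
    refine (isOpen_lt continuous_const (h.continuous_apply o)).inter
      (isOpen_biInter_finset fun u _ => ?_)
    by_cases hu : c z u = 0
    · simpa [hu] using isOpen_lt (h.continuous_apply u) (h.continuous_apply o)
    · simpa [hu] using isOpen_lt continuous_const (h.continuous_apply u)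
  have hD : IsClosed D := by
    refine (isClosed_le continuous_const (h.continuous_apply o)).inter
      (isClosed_biInter fun u _ => ?_)
    by_cases hu : c z u = 0
    · simpa [hu] using isClosed_eq (h.continuous_apply u) continuous_const
    · simpa [hu] using isClosed_eq (h.continuous_apply u) (h.continuous_apply o)
  have hDO : ∀ a ∈ A, a ∈ D → a ∈ O := by
    rintro a haA ⟨hao, ha⟩
    simp only [mem_iInter] at ha
    have hpos : 0 < c a o := hz0.trans_le hao
    -- A point of `A` in `D` at the exact height of `z` would agree with `z` on `I`, against the
    -- choice of the basic neighbourhood.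
    refine ⟨show c z o < c a o from lt_of_le_of_ne hao fun e => ?_, ?_⟩
    · have : c a ∈ (I : Set ι).pi U := by
        intro u hu
        have hau := ha u hu
        have : c a u = c z u := by
          by_cases hu0 : c z u = 0
          · rw [hau.1 hu0, hu0]
          · rw [hau.2 hu0, ← e, (h.eq_or_eq z u).resolve_left hu0]
        rw [this]
        exact (hU u hu).2
      exact hsub this ⟨a, ⟨haA, e.symm⟩, rfl⟩
    · simp only [mem_iInter]
      intro u hu
      have hau := ha u hu
      refine ⟨fun hu0 => ?_, fun hu0 => ?_⟩
      · rw [hau.1 hu0]; exact hpos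
      · rw [hau.2 hu0]; exact hpos
  have hOD : O ⊆ D := by
    rintro a ⟨hao, ha⟩
    simp only [mem_iInter] at ha
    refine ⟨(show c z o < c a o from hao).le, ?_⟩
    simp only [mem_iInter]
    intro u hu
    have hau := ha u hu
    refine ⟨fun hu0 => (h.eq_or_eq a u).resolve_right (hau.1 hu0).ne, fun hu0 =>
      (h.eq_or_eq a u).resolve_left (hau.2 hu0).ne'⟩
  have hxO : x ∈ O := by
    obtain ⟨s, h0, h1, hs⟩ := hz
    have hs0 : s ≠ 0 := by
      rintro rfl
      apply hzt; apply h.injective; rw [hs, h.top, zero_smul]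
    refine ⟨hzx, ?_⟩
    simp only [mem_iInter]
    intro u hu
    refine ⟨fun hu0 => ?_, fun hu0 => ?_⟩
    · have : c x u = 0 := by simpa [hs, hs0] using hu0
      rw [this]
      exact h.pos hxt
    · have : c x u ≠ 0 := by simpa [hs, hs0] using hu0
      rw [(h.eq_or_eq x u).resolve_left this]
      exact h.pos hxt
  have htD : t ∈ Dᶜ := by
    rintro ⟨hto, -⟩
    have : c z o ≤ c t o := hto
    rw [h.top] at this
    exact absurd this (not_le.2 hz0)
  obtain ⟨a, haA, haO, haD⟩ := hA.2.2 O Dᶜ hO hD.isOpen_compl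
    (fun a ha => by
      by_cases haD : a ∈ D
      · exact Or.inl (hDO a ha haD)
      · exact Or.inr haD) ⟨x, hx, hxO⟩ ⟨t, ht, htD⟩
  exact haD (hOD haO)

/-- A connected set missing the centre lies in a single direction. -/
theorem eq_zero_iff_of_isPreconnected (h : IsStarChart c o t) {A : Set X}
    (hA : IsPreconnected A) (ht : t ∉ A) {x y : X} (hx : x ∈ A) (hy : y ∈ A) (u : ι) :
    c x u = 0 ↔ c y u = 0 := by
  have key : ∀ x ∈ A, ∀ y ∈ A, c x u = 0 → c y u = 0 := by
    intro x hx y hy hxu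
    by_contra hyu
    have hne : ∀ a ∈ A, a ≠ t := fun a ha e => ht (e ▸ ha)
    -- Off the centre the two values 0 and the height are distinct, so each alternative is an open
    -- condition.
    obtain ⟨a, -, ha1, ha2⟩ := hA {a | c a u < c a o} {a | 0 < c a u}
      (isOpen_lt (h.continuous_apply u) (h.continuous_apply o))
      (isOpen_lt continuous_const (h.continuous_apply u))
      (fun a ha => by
        rcases h.eq_or_eq a u with hau | hau
        · left
          rw [mem_ofPred_eq, hau]
          exact h.pos (hne a ha)
        · right
          rw [mem_ofPred_eq, hau]
          exact h.pos (hne a ha))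
      ⟨x, hx, by rw [mem_ofPred_eq, hxu]; exact h.pos (hne x hx)⟩
      ⟨y, hy, by
        rw [mem_ofPred_eq, (h.eq_or_eq y u).resolve_left hyu]; exact h.pos (hne y hy)⟩
    rcases h.eq_or_eq a u with hau | hau
    · exact (show 0 < c a u from ha2).ne' hau
    · exact (show c a u < c a o from ha1).ne hau
  exact ⟨key x hx y hy, key y hy x hx⟩

theorem mem_ray_of_isPreconnected (h : IsStarChart c o t) {A : Set X}
    (hA : IsPreconnected A) (ht : t ∉ A) {x y : X} (hx : x ∈ A) (hy : y ∈ A)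
    (hle : c y o ≤ c x o) : y ∈ ray c x :=
  h.mem_ray_of_forall (fun e => ht (e ▸ hx))
    (fun u => h.eq_zero_iff_of_isPreconnected hA ht hx hy u) hle

theorem mem_of_isPreconnected (h : IsStarChart c o t) {A : Set X}
    (hA : IsPreconnected A) (ht : t ∉ A) {x y z : X} (hx : x ∈ A) (hy : y ∈ A)
    (hz : z ∈ ray c y) (hxz : c x o ≤ c z o) : z ∈ A := by
  obtain ⟨a, ha, hao⟩ := hA.intermediate_value hx hy (h.continuous_apply o).continuousOn
    ⟨hxz, h.le_of_mem_ray hz⟩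
  have hay : a ∈ ray c y :=
    h.mem_ray_of_isPreconnected hA ht hy ha (hao.le.trans (h.le_of_mem_ray hz))
  rwa [← h.eq_of_mem_ray hay hz hao]

theorem mem_of_isSubcontinuum (h : IsStarChart c o t) {A : Set X}
    (hA : IsSubcontinuum A) {x y z : X} (hx : x ∈ A) (hy : y ∈ A)
    (hz : z ∈ ray c y) (hxz : c x o ≤ c z o) : z ∈ A := by
  by_cases ht : t ∈ A
  · exact h.ray_subset hA ht hy hz
  · exact h.mem_of_isPreconnected hA.2.2 ht hx hy hz hxz

variable [CompactSpace X]

theorem isArcBetween (h : IsStarChart c o t) {a b : ℝ} (hab : a < b) {g : ℝ → ι → ℝ}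
    (hg : ContinuousOn g (Icc a b)) (hr : ∀ s ∈ Icc a b, ∃ z, c z = g s)
    (hi : InjOn g (Icc a b)) {x y : X} (hx : c x = g a) (hy : c y = g b) :
    IsArcBetween {z | ∃ s ∈ Icc a b, c z = g s} x y := by
  have hemb : IsInducing c := (h.continuous.isClosedEmbedding h.injective).isInducing
  have : Nonempty X := ⟨x⟩
  choose! γ hγ using hr
  have hγc : ContinuousOn γ (Icc a b) := by
    rw [hemb.continuousOn_iff]
    exact hg.congr hγ
  have hγi : InjOn γ (Icc a b) := fun s hs s' hs' e => by
    apply hi hs hs'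
    rw [← hγ s hs, ← hγ s' hs', e]
  have h1 := isArcBetween_image hab hγc hγi
  have e1 : γ a = x := h.injective ((hγ a (left_mem_Icc.2 hab.le)).trans hx.symm)
  have e2 : γ b = y := h.injective ((hγ b (right_mem_Icc.2 hab.le)).trans hy.symm)
  rw [e1, e2] at h1
  convert h1 using 1
  ext z
  constructor
  · rintro ⟨s, hs, e⟩
    exact ⟨s, hs, h.injective ((hγ s hs).trans e.symm)⟩
  · rintro ⟨s, hs, rfl⟩
    exact ⟨s, hs, hγ s hs⟩

/-- The part of a ray between two of its points is an arc. -/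
theorem isArcBetween_of_mem_ray (h : IsStarChart c o t) {x y : X} (hx : x ∈ ray c y)
    (hne : x ≠ y) : IsArcBetween {z | z ∈ ray c y ∧ c x o ≤ c z o} x y := by
  have hyt : y ≠ t := by
    rintro rfl
    rw [h.ray_top] at hx
    exact hne hx
  have hy0 := h.pos hyt
  obtain ⟨s, h0, h1, hs⟩ := id hx
  have hs1 : s < 1 := lt_of_le_of_ne h1 fun e => hne (h.injective (by rw [hs, e, one_smul]))
  have := h.isArcBetween hs1 (g := fun r => r • c y) (x := x) (y := y) (by fun_prop)
    (fun r hr => h.exists_smul y r (h0.trans hr.1) hr.2)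
    (fun r _ r' _ e => by
      have : r * c y o = r' * c y o := congrFun e o
      exact mul_right_cancel₀ hy0.ne' this) hs (by simp)
  convert this using 1
  ext z
  constructor
  · rintro ⟨⟨r, hr0, hr1, hr⟩, hz⟩
    refine ⟨r, ⟨?_, hr1⟩, hr⟩
    rw [hs, hr] at hz
    exact le_of_mul_le_mul_right hz hy0
  · rintro ⟨r, ⟨hr0, hr1⟩, hr⟩
    refine ⟨⟨r, h0.trans hr0, hr1, hr⟩, ?_⟩
    rw [hs, hr]
    exact mul_le_mul_of_nonneg_right hr0 hy0.le

theorem isArcBetween_top_ray (h : IsStarChart c o t) {y : X} (hy : y ≠ t) :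
    IsArcBetween (ray c y) t y := by
  have := h.isArcBetween_of_mem_ray (h.top_mem_ray y) hy.symm
  convert this using 1
  ext z
  simp [h.top, h.nonneg]

/-- The union of two rays in different directions is an arc. -/
theorem isArcBetween_union (h : IsStarChart c o t) {x y : X} (hxy : x ∉ ray c y)
    (hyx : y ∉ ray c x) : IsArcBetween (ray c x ∪ ray c y) x y := by
  have hxt : x ≠ t := fun e => hxy (e ▸ h.top_mem_ray y)
  have hyt : y ≠ t := fun e => hyx (e ▸ h.top_mem_ray x)
  have hx0 := h.pos hxt
  have hy0 := h.pos hyt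
  have hcross : ∀ {s r : ℝ}, s • c x = r • c y → s = 0 ∧ r = 0 := fun e =>
    ⟨h.eq_zero_of_smul_eq_smul hxy hyx e, h.eq_zero_of_smul_eq_smul hyx hxy e.symm⟩
  have := h.isArcBetween (show (-1 : ℝ) < 1 by norm_num)
    -- Negative parameters run along the ray to `x`, positive ones along the ray to `y`, and 0 is
    -- the centre.
    (g := fun r => max (-r) 0 • c x + max r 0 • c y) (x := x) (y := y) (by fun_prop)
    (fun r hr => by
      rcases le_total r 0 with h0 | h0
      · rw [max_eq_left (neg_nonneg.2 h0), max_eq_right h0, zero_smul, add_zero]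
        exact h.exists_smul x _ (neg_nonneg.2 h0) (by linarith [hr.1])
      · rw [max_eq_right (neg_nonpos.2 h0), max_eq_left h0, zero_smul, zero_add]
        exact h.exists_smul y _ h0 hr.2)
    (fun r hr r' hr' e => by
      simp only at e
      rcases le_total r 0 with h0 | h0 <;> rcases le_total r' 0 with h0' | h0'
      · simp only [max_eq_left (neg_nonneg.2 h0), max_eq_right h0, max_eq_left (neg_nonneg.2 h0'),
          max_eq_right h0', zero_smul, add_zero] at e
        have := mul_right_cancel₀ hx0.ne' (congrFun e o : -r * c x o = -r' * c x o)
        linarith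
      · simp only [max_eq_left (neg_nonneg.2 h0), max_eq_right h0,
          max_eq_right (neg_nonpos.2 h0'), max_eq_left h0', zero_smul, add_zero, zero_add] at e
        have := hcross e
        linarith
      · simp only [max_eq_left (neg_nonneg.2 h0'), max_eq_right h0',
          max_eq_right (neg_nonpos.2 h0), max_eq_left h0, zero_smul, add_zero, zero_add] at e
        have := hcross e.symm
        linarith
      · simp only [max_eq_right (neg_nonpos.2 h0), max_eq_left h0,
          max_eq_right (neg_nonpos.2 h0'), max_eq_left h0', zero_smul, zero_add] at e
        exact mul_right_cancel₀ hy0.ne' (congrFun e o : r * c y o = r' * c y o))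
    (by simp) (by simp)
  convert this using 1
  ext z
  constructor
  · rintro (⟨s, h0, h1, hs⟩ | ⟨s, h0, h1, hs⟩)
    · exact ⟨-s, ⟨by linarith, by linarith⟩, by simp [h0, hs]⟩
    · exact ⟨s, ⟨by linarith, by linarith⟩, by simp [h0, hs]⟩
  · rintro ⟨s, ⟨h0, h1⟩, hs⟩
    rcases le_total s 0 with hs0 | hs0
    · left
      exact ⟨-s, by linarith, by linarith, by simp [hs0, hs]⟩
    · right
      exact ⟨s, by linarith, by linarith, by simp [hs0, hs]⟩

/-- Any two points are joined by an arc that lies in every subcontinuum containing them and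
meets the tips of the star only in its endpoints. -/
theorem exists_isArcBetween (h : IsStarChart c o t) {x y : X} (hne : x ≠ y) :
    ∃ C, IsArcBetween C x y ∧ (∀ A, IsSubcontinuum A → x ∈ A → y ∈ A → C ⊆ A) ∧
      ∀ e ∈ C, IsTip c t e → e = x ∨ e = y := by
  have key : ∀ x y : X, x ≠ y → x ∈ ray c y →
      ∃ C, IsArcBetween C x y ∧ (∀ A, IsSubcontinuum A → x ∈ A → y ∈ A → C ⊆ A) ∧
        ∀ e ∈ C, IsTip c t e → e = x ∨ e = y := fun x y hne hx =>
    ⟨_, h.isArcBetween_of_mem_ray hx hne,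
      fun A hA hxA hyA z hz => h.mem_of_isSubcontinuum hA hxA hyA hz.1 hz.2,
      fun e he hT => Or.inr (hT.2 y he.1).symm⟩
  by_cases hxy : x ∈ ray c y
  · exact key x y hne hxy
  by_cases hyx : y ∈ ray c x
  · obtain ⟨C, h1, h2, h3⟩ := key y x hne.symm hyx
    exact ⟨C, h1.symm, fun A hA hx hy => h2 A hA hy hx, fun e he hT => (h3 e he hT).symm⟩
  refine ⟨_, h.isArcBetween_union hxy hyx, fun A hA hxA hyA => ?_, ?_⟩
  · have ht : t ∈ A := by
      by_contra ht
      rcases le_total (c x o) (c y o) with hle | hle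
      · exact hxy (h.mem_ray_of_isPreconnected hA.2.2 ht hyA hxA hle)
      · exact hyx (h.mem_ray_of_isPreconnected hA.2.2 ht hxA hyA hle)
    exact union_subset (h.ray_subset hA ht hxA) (h.ray_subset hA ht hyA)
  · rintro e (he | he) hT
    · exact Or.inl (hT.2 x he).symm
    · exact Or.inr (hT.2 y he).symm

end IsStarChart

end Stars

end EPGFan

namespace EPGFan

/-! ### Ramification points, and why a star is a smooth fan. -/

section Triod

/-- The three legs of the simple triod, parametrized by their distance from the top. -/
def triodLeg (k : Fin 3) (s : ℝ) : ℝ × ℝ :=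
  ![(s, 0), (-s, 0), (0, s)] k

theorem triodLeg_mem (k : Fin 3) {s : ℝ} (h0 : 0 ≤ s) (h1 : s ≤ 1) :
    triodLeg k s ∈ simpleTriod := by
  fin_cases k
  · exact Or.inl ⟨⟨by simp [triodLeg]; linarith, by simpa [triodLeg]⟩, rfl⟩
  · exact Or.inl ⟨⟨by simpa [triodLeg], by simp [triodLeg]; linarith⟩, rfl⟩
  · exact Or.inr ⟨rfl, ⟨by simpa [triodLeg], by simpa [triodLeg]⟩⟩

theorem exists_triodLeg_eq {p : ℝ × ℝ} (hp : p ∈ simpleTriod) :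
    ∃ k s, 0 ≤ s ∧ s ≤ 1 ∧ triodLeg k s = p := by
  obtain ⟨a, b⟩ := p
  rcases hp with ⟨⟨h1, h2⟩, h3⟩ | ⟨h1, h2, h3⟩
  · simp only [mem_singleton_iff] at h1 h2 h3
    subst h3
    rcases le_total 0 a with ha | ha
    · exact ⟨0, a, ha, h2, rfl⟩
    · exact ⟨1, -a, by linarith, by linarith, by simp [triodLeg]⟩
  · simp only [mem_singleton_iff] at h1 h2 h3
    subst h1
    exact ⟨2, b, h2, h3, rfl⟩

theorem triodLeg_zero (k : Fin 3) : triodLeg k 0 = (0, 0) := by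
  fin_cases k <;> simp [triodLeg]

theorem continuous_triodLeg (k : Fin 3) : Continuous (triodLeg k) := by
  fin_cases k
  · exact continuous_id.prodMk continuous_const
  · exact continuous_neg.prodMk continuous_const
  · exact continuous_const.prodMk continuous_id

theorem triodLeg_injective (k : Fin 3) : Function.Injective (triodLeg k) := by
  intro s s' h
  fin_cases k <;> simpa [triodLeg] using h

theorem eq_zero_of_triodLeg_eq {k k' : Fin 3} (hk : k ≠ k') {s s' : ℝ} (hs : 0 ≤ s) (hs' : 0 ≤ s')
    (h : triodLeg k s = triodLeg k' s') : s = 0 := by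
  fin_cases k <;> fin_cases k' <;> simp_all [triodLeg] <;> linarith

theorem isCompact_simpleTriod : IsCompact simpleTriod :=
  (isCompact_Icc.prod isCompact_singleton).union (isCompact_singleton.prod isCompact_Icc)

end Triod

namespace IsStarChart

variable {X ι : Type*} [MetricSpace X] {c : X → ι → ℝ} {o : ι} {t : X}

/-- Two connected sets leaving a point `x` of a star to the same side meet outside `x`. -/
theorem exists_mem_inter (h : IsStarChart c o t) {J K : Set X} (hJ : IsPreconnected J)
    (hK : IsPreconnected K) (hJt : t ∉ J) (hKt : t ∉ K) {x a b : X} (hxJ : x ∈ J) (hxK : x ∈ K)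
    (ha : a ∈ J) (hb : b ∈ K)
    (hab : c x o < c a o ∧ c x o < c b o ∨ c a o < c x o ∧ c b o < c x o) :
    ∃ z ∈ J ∩ K, z ≠ x := by
  have main : ∀ (J K : Set X), IsPreconnected J → IsPreconnected K → t ∉ J → t ∉ K →
      ∀ a b, x ∈ J → x ∈ K → a ∈ J → b ∈ K → c a o ≤ c b o →
      (c x o < c a o ∧ c x o < c b o ∨ c a o < c x o ∧ c b o < c x o) → ∃ z ∈ J ∩ K, z ≠ x := by
    intro J K hJ hK hJt hKt a b hxJ hxK ha hb hle hab
    rcases hab with ⟨h1, h2⟩ | ⟨h1, h2⟩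
    · refine ⟨a, ⟨ha, ?_⟩, fun e => h1.ne (e ▸ rfl)⟩
      have hU : IsPreconnected (J ∪ K) := IsPreconnected.union x hxJ hxK hJ hK
      have hUt : t ∉ J ∪ K := fun ht => ht.elim hJt hKt
      exact h.mem_of_isPreconnected hK hKt hxK hb
        (h.mem_ray_of_isPreconnected hU hUt (Or.inr hb) (Or.inl ha) hle) h1.le
    · refine ⟨b, ⟨?_, hb⟩, fun e => h2.ne (e ▸ rfl)⟩
      exact h.mem_of_isPreconnected hJ hJt ha hxJ
        (h.mem_ray_of_isPreconnected hK hKt hxK hb h2.le) hle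
  rcases le_total (c a o) (c b o) with hle | hle
  · exact main J K hJ hK hJt hKt a b hxJ hxK ha hb hle hab
  · obtain ⟨z, hz, hzx⟩ := main K J hK hJ hKt hJt b a hxK hxJ hb ha hle
      (hab.imp And.symm And.symm)
    exact ⟨z, hz.symm, hzx⟩

/-- Away from the centre, short initial pieces of the three legs of a triod lie in one direction,
where height is injective. Each piece moves up or down from the vertex; two move to the same side
and must overlap. -/
theorem ramificationPoints_subset (h : IsStarChart c o t) : ramificationPoints X ⊆ {t} := by
  rintro x ⟨T, φ, hx⟩
  by_contra hxt
  let γ : Fin 3 → unitInterval → X := fun k s => φ ⟨triodLeg k s, triodLeg_mem k s.2.1 s.2.2⟩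
  have hγc : ∀ k, Continuous (γ k) := fun k =>
    continuous_subtype_val.comp (φ.continuous.comp
      (((continuous_triodLeg k).comp continuous_subtype_val).subtype_mk _))
  have hγ : ∀ k s k' s', γ k s = γ k' s' → triodLeg k s = triodLeg k' s' := fun k s k' s' e =>
    congrArg Subtype.val (φ.injective (Subtype.ext e))
  have hγ0 : ∀ k, γ k 0 = x := by
    intro k
    rw [← hx]
    have : (⟨triodLeg k (0 : unitInterval), triodLeg_mem k (0 : unitInterval).2.1
        (0 : unitInterval).2.2⟩ : simpleTriod) = triodTop :=
      Subtype.ext (triodLeg_zero k)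
    exact congrArg (fun q => (φ q : X)) this
  have hleg : ∀ k, ∃ J, IsPreconnected J ∧ J ⊆ range (γ k) ∧ t ∉ J ∧ x ∈ J ∧
      ∃ a ∈ J, c a o ≠ c x o := by
    intro k
    have hopen : IsOpen {s | γ k s ≠ t} := isOpen_ne_fun (hγc k) continuous_const
    have h0 : (0 : unitInterval) ∈ {s | γ k s ≠ t} := by
      rw [mem_ofPred_eq, hγ0]
      exact hxt
    obtain ⟨δ, hδ, hsub⟩ := exists_Ico_subset_of_mem_nhds (hopen.mem_nhds h0) ⟨1, zero_lt_one⟩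
    obtain ⟨d, hd0, hdδ⟩ := exists_between hδ
    have hJ : IsPreconnected (γ k '' Ico 0 δ) :=
      ordConnected_Ico.isPreconnected.image _ (hγc k).continuousOn
    have hJt : t ∉ γ k '' Ico 0 δ := by
      rintro ⟨s, hs, e⟩
      exact hsub hs e
    have hxJ : x ∈ γ k '' Ico 0 δ := ⟨0, ⟨le_rfl, hδ⟩, hγ0 k⟩
    have hdJ : γ k d ∈ γ k '' Ico 0 δ := ⟨d, ⟨hd0.le, hdδ⟩, rfl⟩
    refine ⟨_, hJ, image_subset_range _ _, hJt, hxJ, γ k d, hdJ, fun e => ?_⟩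
    have h1 := h.eq_of_mem_ray (h.mem_ray_of_isPreconnected hJ hJt hxJ hdJ e.le)
      (mem_ray_self c x) e
    rw [← hγ0 k] at h1
    exact hd0.ne' (Subtype.ext (triodLeg_injective k (hγ _ _ _ _ h1)))
  choose J hJ hJs hJt hxJ a ha hax using hleg
  have hdisj : ∀ k k', k ≠ k' → ∀ z ∈ J k ∩ J k', z = x := by
    rintro k k' hk z ⟨hz, hz'⟩
    obtain ⟨s, rfl⟩ := hJs k hz
    obtain ⟨s', hs'⟩ := hJs k' hz'
    have := eq_zero_of_triodLeg_eq hk s.2.1 s'.2.1 (hγ _ _ _ _ hs'.symm)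
    rw [← hγ0 k]
    exact congrArg (γ k) (Subtype.ext this)
  have hside : ∀ k k', k ≠ k' → ¬ (c x o < c (a k) o ∧ c x o < c (a k') o ∨
      c (a k) o < c x o ∧ c (a k') o < c x o) := by
    intro k k' hk hab
    obtain ⟨z, hz, hzx⟩ := h.exists_mem_inter (hJ k) (hJ k') (hJt k) (hJt k') (hxJ k) (hxJ k')
      (ha k) (ha k') hab
    exact hzx (hdisj k k' hk z hz)
  have s01 := hside 0 1 (by decide)
  have s02 := hside 0 2 (by decide)
  have s12 := hside 1 2 (by decide)
  rcases lt_or_gt_of_ne (hax 0) with h0 | h0 <;> rcases lt_or_gt_of_ne (hax 1) with h1 | h1 <;>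
    rcases lt_or_gt_of_ne (hax 2) with h2 | h2 <;> tauto

variable [CompactSpace X]

theorem top_mem_ramificationPoints (h : IsStarChart c o t) {e : Fin 3 → X}
    (he : ∀ i j, i ≠ j → e i ∉ ray c (e j)) : t ∈ ramificationPoints X := by
  have hemb : IsInducing c := (h.continuous.isClosedEmbedding h.injective).isInducing
  let g : ℝ × ℝ → ι → ℝ := fun p =>
    -- On the triod at most one summand is nonzero, so each leg is mapped linearly onto one ray.
    max p.1 0 • c (e 0) + max (-p.1) 0 • c (e 1) + p.2 • c (e 2)
  have hg : Continuous g := by fun_prop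
  have hgleg : ∀ k s, 0 ≤ s → g (triodLeg k s) = s • c (e k) := by
    intro k s hs
    fin_cases k <;> simp [g, triodLeg, hs]
  have hgmem : ∀ p : simpleTriod, ∃ z, c z = g p := by
    rintro ⟨p, hp⟩
    obtain ⟨k, s, h0, h1, rfl⟩ := exists_triodLeg_eq hp
    rw [hgleg k s h0]
    exact h.exists_smul _ s h0 h1
  choose γ hγ using hgmem
  have hγc : Continuous γ := by
    rw [hemb.continuous_iff]
    have : c ∘ γ = fun p : simpleTriod => g p := funext hγ
    rw [this]
    exact hg.comp continuous_subtype_val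
  have hγi : Function.Injective γ := by
    rintro ⟨p, hp⟩ ⟨q, hq⟩ hpq
    obtain ⟨k, s, h0, h1, rfl⟩ := exists_triodLeg_eq hp
    obtain ⟨k', s', h0', h1', rfl⟩ := exists_triodLeg_eq hq
    have heq : s • c (e k) = s' • c (e k') := by
      rw [← hgleg k s h0, ← hgleg k' s' h0']
      exact (hγ _).symm.trans ((congrArg c hpq).trans (hγ _))
    refine Subtype.ext ?_
    change triodLeg k s = triodLeg k' s'
    by_cases hk : k = k'
    · subst hk
      have hkt : e k ≠ t := by
        intro ht
        have : ∃ j, k ≠ j := exists_ne k |>.imp fun _ h => h.symm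
        obtain ⟨j, hj⟩ := this
        exact he k j hj (ht ▸ h.top_mem_ray _)
      have := mul_right_cancel₀ (h.pos hkt).ne'
        (congrFun heq o : s * c (e k) o = s' * c (e k) o)
      rw [this]
    · have e1 := h.eq_zero_of_smul_eq_smul (he _ _ hk) (he _ _ (Ne.symm hk)) heq
      have e2 := h.eq_zero_of_smul_eq_smul (he _ _ (Ne.symm hk)) (he _ _ hk) heq.symm
      rw [e1, e2, triodLeg_zero, triodLeg_zero]
  have : CompactSpace simpleTriod := isCompact_iff_compactSpace.1 isCompact_simpleTriod
  let f : simpleTriod → range γ := fun p => ⟨γ p, mem_range_self p⟩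
  let φ : simpleTriod ≃ₜ range γ := Continuous.homeoOfEquivCompactToT2
    (f := Equiv.ofBijective f ⟨fun p q e => hγi (congrArg Subtype.val e),
      fun ⟨_, p, hp⟩ => ⟨p, Subtype.ext hp⟩⟩) (hγc.subtype_mk _)
  refine ⟨range γ, φ, ?_⟩
  change γ triodTop = t
  apply h.injective
  rw [hγ, h.top]
  simp [g, triodTop]

theorem isSubcontinuum_ray (h : IsStarChart c o t) (x : X) : IsSubcontinuum (ray c x) := by
  by_cases hx : x = t
  · rw [hx, h.ray_top]
    exact ⟨isCompact_singleton, isConnected_singleton⟩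
  · exact (h.isArcBetween_top_ray hx).1.isSubcontinuum

/-- Hereditary unicoherence holds because two points are joined by an arc contained in every
subcontinuum through both, hence in the intersection of any two such subcontinua. -/
theorem isDendroid (h : IsStarChart c o t) : IsDendroid X := by
  refine ⟨⟨inferInstance, ?_⟩, fun x y hne => ?_, ?_⟩
  · rw [connectedSpace_iff_univ]
    refine ⟨⟨t, trivial⟩, isPreconnected_of_forall t fun x _ => ?_⟩
    exact ⟨ray c x, subset_univ _, h.top_mem_ray x, mem_ray_self c x,
      (h.isSubcontinuum_ray x).2.2⟩
  · obtain ⟨C, hC, -⟩ := h.exists_isArcBetween hne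
    exact ⟨C, hC⟩
  · intro Y hY A B hA hB hYAB
    refine ⟨?_, isPreconnected_of_forall_pair fun x hx y hy => ?_⟩
    · have := isPreconnected_closed_iff.1 hY.2.2 A B hA.1.isClosed hB.1.isClosed hYAB.subset
        (by rw [hYAB, inter_eq_right.2 subset_union_left]; exact hA.2.1)
        (by rw [hYAB, inter_eq_right.2 subset_union_right]; exact hB.2.1)
      exact this.mono inter_subset_right
    · by_cases hne : x = y
      · subst hne
        exact ⟨{x}, singleton_subset_iff.2 hx, rfl, rfl, isPreconnected_singleton⟩
      · obtain ⟨C, hC, hCs, -⟩ := h.exists_isArcBetween hne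
        exact ⟨C, subset_inter (hCs A hA hx.1 hy.1) (hCs B hB hx.2 hy.2), hC.left_mem,
          hC.right_mem, hC.1.isSubcontinuum.2.2⟩

theorem isFan (h : IsStarChart c o t) {e : Fin 3 → X}
    (he : ∀ i j, i ≠ j → e i ∉ ray c (e j)) : IsFan X t :=
  ⟨h.isDendroid, h.ramificationPoints_subset.antisymm
    (singleton_subset_iff.2 (h.top_mem_ramificationPoints he))⟩

theorem segment_top (h : IsStarChart c o t) (x : X) : segment t x = ray c x := by
  by_cases hx : x = t
  · subst hx
    have : {A : Set X | IsArcBetween A x x} = ∅ :=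
      eq_empty_of_forall_notMem fun A hA => hA.ne rfl
    rw [segment, this, h.ray_top]
    simp
  · obtain ⟨C, hC, hCs, -⟩ := h.exists_isArcBetween (Ne.symm hx)
    have huniq : ∀ A, IsArcBetween A t x → A = C := fun A hA =>
      (hA.eq_of_subset hC.1.isSubcontinuum.2.2 hC.left_mem hC.right_mem
        (hCs A hA.1.isSubcontinuum hA.left_mem hA.right_mem)).symm
    have hray := h.isArcBetween_top_ray hx
    have : {A : Set X | IsArcBetween A t x} = {ray c x} := by
      ext A
      constructor
      · intro hA
        exact (huniq A hA).trans (huniq _ hray).symm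
      · rintro rfl
        exact hray
    rw [segment, this, sUnion_singleton, union_eq_right]
    rintro z (rfl | rfl)
    · exact h.top_mem_ray x
    · exact mem_ray_self c z

/-- Matching points with the same scaling factor shows that rays are no farther apart than their
outer ends. -/
theorem isSmooth (h : IsStarChart c o t) : IsSmooth X t := by
  intro x a hx
  have hle : ∀ y z : X, Metric.hausdorffEDist (segment t y) (segment t z) ≤ edist y z := by
    intro y z
    rw [h.segment_top, h.segment_top]
    refine Metric.hausdorffEDist_le_of_mem_edist ?_ ?_
    · rintro y' ⟨s, h0, h1, hs⟩
      obtain ⟨z', hz'⟩ := h.exists_smul z s h0 h1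
      exact ⟨z', ⟨s, h0, h1, hz'⟩, h.edist_le s y z y' z' h0 h1 hs hz'⟩
    · rintro z' ⟨s, h0, h1, hs⟩
      obtain ⟨y', hy'⟩ := h.exists_smul y s h0 h1
      refine ⟨y', ⟨s, h0, h1, hy'⟩, ?_⟩
      rw [edist_comm]
      exact h.edist_le s y z y' z' h0 h1 hy' hs
  exact tendsto_of_tendsto_of_tendsto_of_le_of_le tendsto_const_nhds
    (tendsto_iff_edist_tendsto_0.1 hx) (fun _ => zero_le) (fun n => hle _ _)

/-- The incomparable pair `x`, `y` provides an arc with the centre in its interior, so the centre is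
not an endpoint. A tip is never interior to an arc, since the other points of that arc are joined
within it by arcs avoiding the tip. -/
theorem mem_endpoints_iff (h : IsStarChart c o t) {x y : X} (hxy : x ∉ ray c y)
    (hyx : y ∉ ray c x) {e : X} : e ∈ endpoints X ↔ IsTip c t e := by
  constructor
  · intro he
    have hends : ∀ {A : Set X} {a b : X}, IsArcBetween A a b → e ∈ A → e = a ∨ e = b := by
      intro A a b hA heA
      have := he A hA.1 heA
      rwa [hA.2] at this
    refine ⟨?_, fun a ha => ?_⟩
    · rintro rfl
      rcases hends (h.isArcBetween_union hxy hyx) (Or.inl (h.top_mem_ray x)) with rfl | rfl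
      · exact hxy (h.top_mem_ray y)
      · exact hyx (h.top_mem_ray x)
    · have het : e ≠ t := by
        rintro rfl
        rcases hends (h.isArcBetween_union hxy hyx) (Or.inl (h.top_mem_ray x)) with rfl | rfl
        · exact hxy (h.top_mem_ray y)
        · exact hyx (h.top_mem_ray x)
      have hat : a ≠ t := by
        rintro rfl
        rw [h.ray_top] at ha
        exact het ha
      exact ((hends (h.isArcBetween_top_ray hat) ha).resolve_left het).symm
  · rintro he A ⟨φ⟩ heA
    have hA : IsSubcontinuum A := IsArc.isSubcontinuum ⟨φ⟩
    refine ⟨heA, ?_, isPreconnected_of_forall_pair fun a ha b hb => ?_⟩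
    · by_contra hemp
      rw [not_nonempty_iff_eq_empty, sdiff_eq_empty] at hemp
      have e0 := hemp (φ 0).2
      have e1 := hemp (φ 1).2
      exact zero_ne_one (φ.injective (Subtype.ext (e0.trans e1.symm)))
    · by_cases hne : a = b
      · subst hne
        exact ⟨{a}, singleton_subset_iff.2 ha, rfl, rfl, isPreconnected_singleton⟩
      · obtain ⟨C, hC, hCs, hCe⟩ := h.exists_isArcBetween hne
        refine ⟨C, fun z hz => ⟨hCs A hA ha.1 hb.1 hz, ?_⟩, hC.left_mem,
          hC.right_mem, hC.1.isSubcontinuum.2.2⟩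
        rintro rfl
        rcases hCe z hz he with rfl | rfl
        · exact ha.2 rfl
        · exact hb.2 rfl

end IsStarChart

end EPGFan

namespace EPGFan

/-! ### Transport by homeomorphisms, and the construction of stars. -/

section Homeomorph

variable {X : Type*} [MetricSpace X] (g : X ≃ₜ X)

theorem IsArc.image {A : Set X} (hA : IsArc A) : IsArc (g '' A) := by
  obtain ⟨φ⟩ := hA
  exact ⟨φ.trans (g.image A)⟩

theorem arcEndpoints_image (A : Set X) : arcEndpoints (g '' A) = g '' arcEndpoints A := by
  have key : ∀ a, IsConnected (g '' A \ {g a}) ↔ IsConnected (A \ {a}) := by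
    intro a
    rw [← image_singleton, ← image_sdiff g.injective, g.isConnected_image]
  ext b
  constructor
  · rintro ⟨⟨a, ha, rfl⟩, hb⟩
    exact ⟨a, ⟨ha, (key a).1 hb⟩, rfl⟩
  · rintro ⟨a, ⟨ha, hb⟩, rfl⟩
    exact ⟨mem_image_of_mem g ha, (key a).2 hb⟩

theorem IsArcBetween.image {A : Set X} {x y : X} (hA : IsArcBetween A x y) :
    IsArcBetween (g '' A) (g x) (g y) :=
  ⟨hA.1.image g, by rw [arcEndpoints_image, hA.2, image_pair]⟩

theorem segment_image_subset (x y : X) : g '' segment x y ⊆ segment (g x) (g y) := by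
  rintro _ ⟨z, (hz | ⟨A, hA, hz⟩), rfl⟩
  · left
    rw [← image_pair]
    exact mem_image_of_mem g hz
  · exact Or.inr ⟨g '' A, hA.image g, mem_image_of_mem g hz⟩

theorem image_segment (x y : X) : g '' segment x y = segment (g x) (g y) := by
  refine (segment_image_subset g x y).antisymm fun z hz => ?_
  have := segment_image_subset g.symm (g x) (g y) (mem_image_of_mem g.symm hz)
  rw [g.symm_apply_apply, g.symm_apply_apply] at this
  exact ⟨_, this, g.apply_symm_apply z⟩

theorem image_endpoints_subset : g '' endpoints X ⊆ endpoints X := by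
  rintro _ ⟨e, he, rfl⟩ A hA heA
  have h1 : e ∈ g.symm '' A := ⟨g e, heA, g.symm_apply_apply e⟩
  have h2 := he _ (hA.image g.symm) h1
  rw [arcEndpoints_image] at h2
  obtain ⟨a, ha, hae⟩ := h2
  rwa [← hae, g.apply_symm_apply]

theorem image_endpoints : g '' endpoints X = endpoints X := by
  refine (image_endpoints_subset g).antisymm fun z hz => ?_
  exact ⟨_, image_endpoints_subset g.symm (mem_image_of_mem _ hz), g.apply_symm_apply z⟩

/-- If homeomorphisms fixing `t` act transitively on endpoints, then endpoint generation can be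
checked on a single blade. -/
theorem isEndpointGenerated_of_transitive {t e₀ : X} {S : Set unitInterval}
    (hg : ∀ e ∈ endpoints X, ∃ g : X ≃ₜ X, g e₀ = e ∧ g t = t)
    (φ : unitInterval ≃ₜ segment t e₀) (hφ : (φ 0 : X) = t)
    (hS : (fun s => (φ s : X)) '' S = segment t e₀ ∩ closure (endpoints X \ segment t e₀)) :
    IsEndpointGenerated X t S := by
  rintro _ ⟨e, he, rfl⟩
  obtain ⟨g, rfl, hgt⟩ := hg e he
  have him : g '' segment t e₀ = segment t (g e₀) := by rw [image_segment, hgt]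
  rw [← him]
  refine ⟨φ.trans (g.image _), ?_, ?_⟩
  · change g (φ 0 : X) = t
    rw [hφ, hgt]
  · have : (fun s => ((φ.trans (g.image (segment t e₀))) s : X)) '' S =
        g '' ((fun s => (φ s : X)) '' S) := by
      rw [image_image]; rfl
    rw [this, hS, image_inter g.injective, g.image_closure, image_sdiff g.injective,
      image_endpoints]

end Homeomorph

namespace IsStarChart

section Constructions

variable {X ι : Type*} [MetricSpace X] {c : X → ι → ℝ} {o : ι} {t : X} [CompactSpace X]

theorem isInducing (h : IsStarChart c o t) : IsInducing c :=
  (h.continuous.isClosedEmbedding h.injective).isInducing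

/-- The induced map is an involution, so continuity of its inverse is free. -/
theorem exists_homeomorph (h : IsStarChart c o t) {H : (ι → ℝ) → ι → ℝ} (hH : Continuous H)
    (hmem : ∀ x, ∃ y, c y = H (c x)) (hinv : ∀ x, H (H (c x)) = c x) :
    ∃ g : X ≃ₜ X, ∀ x, c (g x) = H (c x) := by
  choose f hf using hmem
  have hff : Function.Involutive f := fun x => h.injective (by rw [hf, hf, hinv])
  have hfc : Continuous f := by
    rw [h.isInducing.continuous_iff]
    have : c ∘ f = fun x => H (c x) := funext hf
    rw [this]
    exact hH.comp h.continuous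
  exact ⟨⟨hff.toPerm, hfc, hfc⟩, hf⟩

theorem exists_homeomorph_segment (h : IsStarChart c o t) {e : X} (he : e ≠ t) :
    ∃ φ : unitInterval ≃ₜ segment t e, ∀ s, c (φ s) = (s : ℝ) • c e := by
  rw [h.segment_top]
  choose γ hγ using fun s : unitInterval => h.exists_smul e s s.2.1 s.2.2
  have hγc : Continuous γ := by
    rw [h.isInducing.continuous_iff]
    have : c ∘ γ = fun s : unitInterval => (s : ℝ) • c e := funext hγ
    rw [this]
    fun_prop
  let f : unitInterval → ray c e := fun s => ⟨γ s, s, s.2.1, s.2.2, hγ s⟩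
  have hf : Function.Bijective f := by
    constructor
    · intro s s' hss
      have h1 : γ s = γ s' := congrArg Subtype.val hss
      have h2 : (s : ℝ) • c e = (s' : ℝ) • c e := by rw [← hγ, ← hγ, h1]
      exact Subtype.ext (mul_right_cancel₀ (h.pos he).ne' (congrFun h2 o))
    · rintro ⟨z, s, h0, h1, hs⟩
      exact ⟨⟨s, h0, h1⟩, Subtype.ext (h.injective ((hγ _).trans hs.symm))⟩
  exact ⟨Continuous.homeoOfEquivCompactToT2 (f := Equiv.ofBijective f hf) (hγc.subtype_mk _), hγ⟩

theorem isFan_of_isTip (h : IsStarChart c o t) {e : Fin 3 → X} (he : ∀ i, IsTip c t (e i))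
    (hi : Function.Injective e) : IsFan X t :=
  h.isFan fun i _ hij => notMem_ray_of_isTip (he i) fun h => hij (hi h)

theorem mem_endpoints_iff_isTip (h : IsStarChart c o t) {a b : X} (ha : IsTip c t a)
    (hb : IsTip c t b) (hab : a ≠ b) {e : X} : e ∈ endpoints X ↔ IsTip c t e :=
  h.mem_endpoints_iff (notMem_ray_of_isTip ha hab) (notMem_ray_of_isTip hb hab.symm)

end Constructions

end IsStarChart

/-- A compact star-shaped set of sequences with two-valued coordinates carries a metric for which
the coordinates form a star chart. -/
theorem exists_isStarChart {ι : Type} [Encodable ι] (o : ι) {F : Set (ι → ℝ)} (hF : IsCompact F)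
    (h0 : 0 ∈ F) (hnn : ∀ p ∈ F, 0 ≤ p o) (hval : ∀ p ∈ F, ∀ u, p u = 0 ∨ p u = p o)
    (hsmul : ∀ p ∈ F, ∀ s : ℝ, 0 ≤ s → s ≤ 1 → s • p ∈ F) :
    ∃ (X : Type) (_ : MetricSpace X) (_ : CompactSpace X) (c : X → ι → ℝ) (t : X),
      IsStarChart c o t ∧ range c = F := by
  let m : MetricSpace F :=
    MetricSpace.induced Subtype.val Subtype.val_injective PiCountable.metricSpace
  refine ⟨F, m, isCompact_iff_compactSpace.1 hF, Subtype.val, ⟨0, h0⟩, ?_, Subtype.range_coe⟩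
  refine ⟨continuous_subtype_val, Subtype.val_injective, fun x => hnn x x.2,
    fun x => hval x x.2, rfl, fun x s hs hs1 => ⟨⟨s • x.1, hsmul x x.2 s hs hs1⟩, rfl⟩, ?_⟩
  intro s x y x' y' hs hs1 hx hy
  -- The product metric is a sum of truncated coordinate distances, so scaling can be compared term
  -- by term.
  change (∑' i, min (2⁻¹ ^ Encodable.encode i) (edist (x'.1 i) (y'.1 i)) : ENNReal) ≤
    ∑' i, min (2⁻¹ ^ Encodable.encode i) (edist (x.1 i) (y.1 i))
  refine ENNReal.tsum_le_tsum fun i => min_le_min_left _ ?_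
  rw [hx, hy, edist_dist, edist_dist]
  refine ENNReal.ofReal_le_ofReal ?_
  rw [Pi.smul_apply, Pi.smul_apply, dist_smul₀, Real.norm_of_nonneg hs]
  exact mul_le_of_le_one_left dist_nonneg hs1

end EPGFan

namespace EPGFan

/-! ### The fan of reduced words and its symmetries. -/

section Words

variable (x : ℕ → ℝ)

/-- The map by which a blade of the fan is approached by its `i`-th neighbour. -/
def shrink (i : ℕ) (s : ℝ) : ℝ := x i * s ^ (i + 1)

/-- The inverse of `shrink x i` on the nonnegative reals. -/
noncomputable def unshrink (i : ℕ) (y : ℝ) : ℝ := (y / x i) ^ (((i + 1 : ℕ) : ℝ)⁻¹)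

/-- The length of the blade indexed by a word. -/
def bladeLength : List ℕ → ℝ
  | [] => 1
  | i :: w => shrink x i (bladeLength w)

/-- A word is reduced if no two adjacent letters are equal. -/
def Reduced (w : List ℕ) : Prop := w.IsChain (· ≠ ·)

/-- The point at height `y` on the blade indexed by `w`. -/
def bladePoint (w : List ℕ) (y : ℝ) : List ℕ → ℝ := fun u => if u <+: w then y else 0

/-- The blades indexed by all reduced words. -/
def wordFan : Set (List ℕ → ℝ) :=
  {p | ∃ w y, Reduced w ∧ 0 ≤ y ∧ y ≤ bladeLength x w ∧ p = bladePoint w y}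

/-- The symmetry that exchanges the blades indexed by `w` and `i :: w`. -/
noncomputable def flip (i : ℕ) (p : List ℕ → ℝ) : List ℕ → ℝ
  | [] => unshrink x i (p [i]) + shrink x i (p [] - p [i])
  | [j] => if j = i then shrink x i (p [] - p [i]) else unshrink x i (p [i, j])
  | j :: k :: u => if j = i then (if k = i then 0 else shrink x i (p (k :: u)))
      else unshrink x i (p (i :: j :: k :: u))

variable {x} {r : ℝ}

theorem continuous_shrink (i : ℕ) : Continuous (shrink x i) := by
  unfold shrink; fun_prop

theorem continuous_unshrink (i : ℕ) : Continuous (unshrink x i) := by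
  unfold unshrink
  exact (continuous_id.div_const _).rpow_const fun _ => Or.inr (by positivity)

theorem shrink_zero (i : ℕ) : shrink x i 0 = 0 := by simp [shrink]

theorem unshrink_zero (i : ℕ) : unshrink x i 0 = 0 := by
  rw [unshrink, zero_div, Real.zero_rpow (by positivity)]

theorem unshrink_shrink (hx : ∀ i, 0 < x i) (i : ℕ) {s : ℝ} (hs : 0 ≤ s) :
    unshrink x i (shrink x i s) = s := by
  rw [unshrink, shrink, mul_div_cancel_left₀ _ (hx i).ne']
  exact Real.pow_rpow_inv_natCast hs (by omega)

theorem shrink_unshrink (hx : ∀ i, 0 < x i) (i : ℕ) {y : ℝ} (hy : 0 ≤ y) :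
    shrink x i (unshrink x i y) = y := by
  rw [unshrink, shrink, Real.rpow_inv_natCast_pow (div_nonneg hy (hx i).le) (by omega),
    mul_div_cancel₀ _ (hx i).ne']

theorem unshrink_nonneg (hx : ∀ i, 0 < x i) (i : ℕ) {y : ℝ} (hy : 0 ≤ y) :
    0 ≤ unshrink x i y := Real.rpow_nonneg (div_nonneg hy (hx i).le) _

theorem shrink_nonneg (hx : ∀ i, 0 < x i) (i : ℕ) {s : ℝ} (hs : 0 ≤ s) : 0 ≤ shrink x i s :=
  mul_nonneg (hx i).le (pow_nonneg hs _)

theorem shrink_le_shrink (hx : ∀ i, 0 < x i) (i : ℕ) {s s' : ℝ} (hs : 0 ≤ s) (h : s ≤ s') :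
    shrink x i s ≤ shrink x i s' :=
  mul_le_mul_of_nonneg_left (pow_le_pow_left₀ hs h _) (hx i).le

theorem unshrink_le_unshrink (hx : ∀ i, 0 < x i) (i : ℕ) {y y' : ℝ} (hy : 0 ≤ y) (h : y ≤ y') :
    unshrink x i y ≤ unshrink x i y' :=
  Real.rpow_le_rpow (div_nonneg hy (hx i).le) (div_le_div_of_nonneg_right h (hx i).le)
    (by positivity)

theorem bladeLength_pos (hx : ∀ i, 0 < x i) : ∀ w, 0 < bladeLength x w
  | [] => one_pos
  | i :: w => mul_pos (hx i) (pow_pos (bladeLength_pos hx w) _)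

theorem bladeLength_le_pow (hx : ∀ i, 0 < x i) (hr : ∀ i, x i ≤ r) (hr1 : r ≤ 1) :
    ∀ w, bladeLength x w ≤ r ^ w.length ∧ bladeLength x w ≤ 1
  | [] => by simp [bladeLength]
  | i :: w => by
    obtain ⟨h1, h2⟩ := bladeLength_le_pow hx hr hr1 w
    have h0 := (bladeLength_pos hx w).le
    have hr0 : 0 ≤ r := (hx i).le.trans (hr i)
    have h3 : bladeLength x w ^ (i + 1) ≤ bladeLength x w :=
      pow_le_of_le_one h0 h2 (by omega)
    have h4 : bladeLength x (i :: w) ≤ r * bladeLength x w :=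
      mul_le_mul (hr i) h3 (pow_nonneg h0 _) hr0
    constructor
    · rw [List.length_cons, pow_succ']
      exact h4.trans (mul_le_mul_of_nonneg_left h1 hr0)
    · exact h4.trans (mul_le_one₀ hr1 h0 h2)

/-- Needed so that a point on blade `w` respects the height bounds of all prefixes of `w`, which
makes the fan part of a compact box. -/
theorem bladeLength_append_le (hx : ∀ i, 0 < x i) (hr : ∀ i, x i ≤ r) (hr1 : r ≤ 1)
    (u : List ℕ) : ∀ w, bladeLength x (w ++ u) ≤ bladeLength x w
  | [] => (bladeLength_le_pow hx hr hr1 u).2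
  | i :: w => shrink_le_shrink hx i (bladeLength_pos hx _).le
      (bladeLength_append_le hx hr hr1 u w)

theorem bladeLength_le_of_prefix (hx : ∀ i, 0 < x i) (hr : ∀ i, x i ≤ r) (hr1 : r ≤ 1)
    {u w : List ℕ} (h : u <+: w) : bladeLength x w ≤ bladeLength x u := by
  obtain ⟨v, rfl⟩ := h
  exact bladeLength_append_le hx hr hr1 v u

theorem reduced_nil : Reduced [] := List.IsChain.nil

theorem reduced_singleton (i : ℕ) : Reduced [i] := List.IsChain.singleton i

theorem Reduced.of_prefix {u w : List ℕ} (hw : Reduced w) (h : u <+: w) : Reduced u := by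
  obtain ⟨v, rfl⟩ := h
  exact List.IsChain.left_of_append hw

theorem Reduced.tail {i : ℕ} {w : List ℕ} (hw : Reduced (i :: w)) : Reduced w :=
  List.IsChain.tail hw

theorem Reduced.not_prefix {i : ℕ} {w : List ℕ} (hw : Reduced (i :: w)) (u : List ℕ) :
    ¬ i :: u <+: w := by
  rintro ⟨v, rfl⟩
  exact (List.isChain_cons_cons.1 hw).1 rfl

theorem Reduced.exists_tail_or_cons {w : List ℕ} (hw : Reduced w) (i : ℕ) :
    (∃ v, w = i :: v) ∨ Reduced (i :: w) := by
  rcases w with _ | ⟨j, v⟩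
  · exact Or.inr (reduced_singleton i)
  · by_cases h : i = j
    · exact Or.inl ⟨v, by rw [h]⟩
    · exact Or.inr (List.isChain_cons_cons.2 ⟨h, hw⟩)

theorem bladePoint_nil (w : List ℕ) (y : ℝ) : bladePoint w y [] = y := by simp [bladePoint]

theorem bladePoint_zero (w : List ℕ) : bladePoint w 0 = 0 := by ext u; simp [bladePoint]

theorem smul_bladePoint (s : ℝ) (w : List ℕ) (y : ℝ) :
    s • bladePoint w y = bladePoint w (s * y) := by
  ext u; simp [bladePoint]

theorem eq_of_bladePoint_eq {w w' : List ℕ} {y y' : ℝ} (hy : y ≠ 0)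
    (h : bladePoint w y = bladePoint w' y') : w = w' ∧ y = y' := by
  have hyy : y = y' := by simpa [bladePoint_nil] using congrFun h []
  subst hyy
  refine ⟨?_, rfl⟩
  have h1 : w <+: w' := by
    by_contra hn
    have := congrFun h w
    simp [bladePoint, hn, hy] at this
  have h2 : w' <+: w := by
    by_contra hn
    have := congrFun h w'
    simp [bladePoint, hn, hy.symm] at this
  exact h1.eq_of_length_le h2.length_le

/-- Each coordinate of the image depends on finitely many coordinates. At the empty word the case
distinction is absorbed into a sum: on the fan one of `p [i]` and `p [] - p [i]` vanishes, and
`shrink` and `unshrink` both fix 0. -/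
theorem continuous_flip (i : ℕ) : Continuous (flip x i) := by
  have h1 := continuous_shrink (x := x) i
  have h2 := continuous_unshrink (x := x) i
  refine continuous_pi fun u => ?_
  rcases u with _ | ⟨j, _ | ⟨k, u⟩⟩
  · simp only [flip]
    fun_prop
  · by_cases hj : j = i <;> simp only [flip, hj, if_true, if_false] <;> fun_prop
  · by_cases hj : j = i <;> by_cases hk : k = i <;>
      simp only [flip, hj, hk, if_true, if_false] <;> fun_prop

theorem flip_bladePoint {i : ℕ} {w : List ℕ} (hw : Reduced (i :: w)) (y : ℝ) :
    flip x i (bladePoint w y) = bladePoint (i :: w) (shrink x i y) := by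
  have h0 : ∀ u, ¬ i :: u <+: w := fun u => hw.not_prefix u
  ext u
  rcases u with _ | ⟨j, _ | ⟨k, u⟩⟩
  · simp [flip, h0, unshrink_zero, bladePoint]
  · by_cases hj : j = i <;> simp [flip, hj, h0, bladePoint, unshrink_zero]
  · by_cases hj : j = i
    · by_cases hk : k = i
      · simp [flip, bladePoint, hj, hk, h0]
      · by_cases hp : k :: u <+: w <;> simp [flip, bladePoint, hj, hk, hp, shrink_zero]
    · simp [flip, hj, h0, bladePoint, unshrink_zero]

theorem flip_bladePoint_cons {i : ℕ} {w : List ℕ} (hw : Reduced (i :: w)) (y : ℝ) :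
    flip x i (bladePoint (i :: w) y) = bladePoint w (unshrink x i y) := by
  have h0 : ∀ u, ¬ i :: u <+: w := fun u => hw.not_prefix u
  ext u
  rcases u with _ | ⟨j, _ | ⟨k, u⟩⟩
  · simp [flip, bladePoint, shrink_zero]
  · by_cases hj : j = i
    · subst hj
      simp [flip, bladePoint, h0, shrink_zero]
    · by_cases hp : [j] <+: w <;> simp [flip, bladePoint, hj, hp, unshrink_zero]
  · by_cases hj : j = i
    · subst hj
      by_cases hk : k = j
      · simp [flip, hk, bladePoint, h0]
      · simp [flip, hk, bladePoint, h0, shrink_zero]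
    · by_cases hp : j :: k :: u <+: w <;> simp [flip, bladePoint, hj, hp, unshrink_zero]

theorem flip_mem_and_flip_flip (hx : ∀ i, 0 < x i) (i : ℕ) {p : List ℕ → ℝ} (hp : p ∈ wordFan x) :
    flip x i p ∈ wordFan x ∧ flip x i (flip x i p) = p := by
  obtain ⟨w, y, hw, hy0, hy1, rfl⟩ := hp
  rcases hw.exists_tail_or_cons i with ⟨v, rfl⟩ | hiw
  · have hle : unshrink x i y ≤ bladeLength x v := by
      have := unshrink_le_unshrink hx i hy0 hy1
      rwa [bladeLength, unshrink_shrink hx i (bladeLength_pos hx v).le] at this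
    rw [flip_bladePoint_cons hw]
    refine ⟨⟨v, _, hw.tail, unshrink_nonneg hx i hy0, hle, rfl⟩, ?_⟩
    rw [flip_bladePoint hw, shrink_unshrink hx i hy0]
  · rw [flip_bladePoint hiw]
    refine ⟨⟨i :: w, _, hiw, shrink_nonneg hx i hy0, shrink_le_shrink hx i hy0 hy1, rfl⟩, ?_⟩
    rw [flip_bladePoint_cons hiw, unshrink_shrink hx i hy0]

/-- The closed conditions in `D` force the support of a nonzero point to be a prefix-closed chain of
reduced words. No infinite word arises: a word in the support of a point of height y satisfies y ≤
r^length, and r < 1. The longest word in the support names the blade. -/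
theorem isCompact_wordFan (hx : ∀ i, 0 < x i) (hr : ∀ i, x i ≤ r) (hr1 : r < 1) :
    IsCompact (wordFan x) := by
  let D : Set (List ℕ → ℝ) :=
    (⋂ u, {p | p u * (p u - p []) = 0}) ∩
    (⋂ u, ⋂ (_ : ¬ Reduced u), {p | p u = 0}) ∩
    (⋂ u, ⋂ v, ⋂ (_ : u <+: v), {p | p v ≤ p u}) ∩
    (⋂ u, ⋂ v, ⋂ (_ : ¬ u <+: v), ⋂ (_ : ¬ v <+: u), {p | p u * p v = 0})
  have hc : ∀ u : List ℕ, Continuous fun p : List ℕ → ℝ => p u := fun u => continuous_apply u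
  have hD : IsClosed D := by
    refine IsClosed.inter (IsClosed.inter (IsClosed.inter ?_ ?_) ?_) ?_
    · exact isClosed_iInter fun u =>
        isClosed_eq ((hc u).mul ((hc u).sub (hc []))) continuous_const
    · exact isClosed_iInter fun u => isClosed_iInter fun _ => isClosed_eq (hc u) continuous_const
    · exact isClosed_iInter fun u => isClosed_iInter fun v => isClosed_iInter fun _ =>
        isClosed_le (hc v) (hc u)
    · exact isClosed_iInter fun u => isClosed_iInter fun v => isClosed_iInter fun _ =>
        isClosed_iInter fun _ => isClosed_eq ((hc u).mul (hc v)) continuous_const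
  have hbox : IsCompact (univ.pi fun u => Icc 0 (bladeLength x u)) :=
    isCompact_univ_pi fun u => isCompact_Icc
  convert hbox.inter_right hD using 1
  ext p
  constructor
  · rintro ⟨w, y, hw, hy0, hy1, rfl⟩
    refine ⟨fun u _ => ?_, ?_⟩
    · by_cases hu : u <+: w
      · simpa [bladePoint, hu] using
          ⟨hy0, hy1.trans (bladeLength_le_of_prefix hx hr hr1.le hu)⟩
      · simpa [bladePoint, hu] using (bladeLength_pos hx u).le
    · simp only [D, mem_inter_iff, mem_iInter, mem_ofPred_eq, and_assoc]
      refine ⟨fun u => ?_, fun u hu => ?_, fun u v huv => ?_, fun u v h1 h2 => ?_⟩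
      · by_cases hu : u <+: w <;> simp [bladePoint, hu]
      · have : ¬ u <+: w := fun h => hu (hw.of_prefix h)
        simp [bladePoint, this]
      · by_cases hv : v <+: w
        · simp [bladePoint, hv, huv.trans hv]
        · by_cases hu : u <+: w <;> simp [bladePoint, hu, hv, hy0]
      · by_cases hu : u <+: w
        · by_cases hv : v <+: w
          · exact ((List.prefix_or_prefix_of_prefix hu hv).elim h1 h2).elim
          · simp [bladePoint, hv]
        · simp [bladePoint, hu]
  · rintro ⟨hp, hpD⟩
    simp only [D, mem_inter_iff, mem_iInter, mem_ofPred_eq, and_assoc] at hpD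
    obtain ⟨hval, hred, hmono, hcomp⟩ := hpD
    have hval' : ∀ u, p u = 0 ∨ p u = p [] := fun u =>
      (mul_eq_zero.1 (hval u)).imp id sub_eq_zero.1
    have hp0 : ∀ u, 0 ≤ p u := fun u => (hp u trivial).1
    have hp1 : ∀ u, p u ≤ bladeLength x u := fun u => (hp u trivial).2
    by_cases hy : p [] = 0
    · refine ⟨[], 0, reduced_nil, le_rfl, (bladeLength_pos hx _).le, ?_⟩
      rw [bladePoint_zero]
      ext u
      exact (hval' u).elim id fun h => h.trans hy
    have hypos : 0 < p [] := lt_of_le_of_ne (hp0 _) (Ne.symm hy)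
    obtain ⟨N, hN⟩ := exists_pow_lt_of_lt_one hypos hr1
    have hr0 : 0 ≤ r := (hx 0).le.trans (hr 0)
    let L : Set ℕ := {n | ∃ u, p u ≠ 0 ∧ u.length = n}
    have hLb : BddAbove L := by
      refine ⟨N, ?_⟩
      rintro _ ⟨u, hu, rfl⟩
      by_contra! hlt
      have h1 : p [] ≤ r ^ u.length := by
        rw [← (hval' u).resolve_left hu]
        exact (hp1 u).trans (bladeLength_le_pow hx hr hr1.le u).1
      have h2 : r ^ u.length ≤ r ^ N := pow_le_pow_of_le_one hr0 hr1.le hlt.le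
      linarith
    obtain ⟨w, hw, hwl⟩ := Nat.sSup_mem (s := L) ⟨0, [], hy, rfl⟩ hLb
    have hwv := (hval' w).resolve_left hw
    refine ⟨w, p [], ?_, hp0 _, hwv ▸ hp1 w, ?_⟩
    · by_contra hn
      exact hw (hred w hn)
    · ext u
      by_cases hu : u <+: w
      · have h1 := hmono u w hu
        have : p u ≠ 0 := by
          intro h0
          rw [h0, hwv] at h1
          linarith
        simpa [bladePoint, hu] using (hval' u).resolve_left this
      · simp only [bladePoint, hu, if_false]
        by_contra hpu
        by_cases hwu : w <+: u
        · have hlen : u.length ≤ w.length := hwl ▸ le_csSup hLb ⟨u, hpu, rfl⟩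
          exact hu ((hwu.eq_of_length_le hlen) ▸ List.prefix_rfl)
        · exact (mul_ne_zero hpu hw) (hcomp u w hu hwu)

end Words

end EPGFan

namespace EPGFan

/-! ### Tips of the word fan and their accumulation on the root blade. -/

section WordFan

variable {x : ℕ → ℝ} {r : ℝ} {X : Type*} [MetricSpace X] {c : X → List ℕ → ℝ} {t : X}

/-- Every point lies on the ray to the end of its blade. Conversely, coordinates at nonzero height
determine the word, so a ray through the end of a blade stays on that blade. -/
theorem isTip_iff (hx : ∀ i, 0 < x i) (h : IsStarChart c [] t) (hc : range c = wordFan x) {e : X} :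
    IsTip c t e ↔ ∃ w, Reduced w ∧ c e = bladePoint w (bladeLength x w) := by
  constructor
  · rintro ⟨het, he⟩
    obtain ⟨w, y, hw, hy0, hy1, hey⟩ : c e ∈ wordFan x := hc ▸ mem_range_self e
    have hpos := bladeLength_pos hx w
    obtain ⟨a, ha⟩ : bladePoint w (bladeLength x w) ∈ range c :=
      hc ▸ ⟨w, _, hw, hpos.le, le_rfl, rfl⟩
    refine ⟨w, hw, ?_⟩
    rw [← ha, he a ⟨y / bladeLength x w, div_nonneg hy0 hpos.le, div_le_one_of_le₀ hy1 hpos.le, ?_⟩]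
    rw [ha, smul_bladePoint, div_mul_cancel₀ _ hpos.ne', hey]
  · rintro ⟨w, hw, he⟩
    have hpos := bladeLength_pos hx w
    refine ⟨fun het => ?_, ?_⟩
    · rw [h.eq_top_iff, he, bladePoint_nil] at het
      exact hpos.ne' het
    · rintro a ⟨s, h0, h1, hs⟩
      obtain ⟨w', y', hw', hy0, hy1, hay⟩ : c a ∈ wordFan x := hc ▸ mem_range_self a
      rw [he, hay, smul_bladePoint] at hs
      obtain ⟨rfl, hy⟩ := eq_of_bladePoint_eq hpos.ne' hs
      apply h.injective
      have : y' = bladeLength x w := by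
        refine le_antisymm hy1 ?_
        rw [hy]
        exact mul_le_of_le_one_left hy0 h1
      rw [hay, he, this]

variable [CompactSpace X]

theorem exists_homeomorph_tip (hx : ∀ i, 0 < x i) (h : IsStarChart c [] t)
    (hc : range c = wordFan x) {e₀ : X} (he₀ : c e₀ = bladePoint [] 1) :
    ∀ (w : List ℕ), Reduced w → ∀ e : X, c e = bladePoint w (bladeLength x w) →
      ∃ g : X ≃ₜ X, g e₀ = e ∧ g t = t
  | [], _, e, he => ⟨Homeomorph.refl X, h.injective (he₀.trans he.symm), rfl⟩
  | i :: w, hw, e, he => by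
    obtain ⟨a, ha⟩ : bladePoint w (bladeLength x w) ∈ range c :=
      hc ▸ ⟨w, _, hw.tail, (bladeLength_pos hx w).le, le_rfl, rfl⟩
    obtain ⟨g, hg, hgt⟩ := exists_homeomorph_tip hx h hc he₀ w hw.tail a ha
    have hmem : ∀ z, c z ∈ wordFan x := fun z => hc ▸ mem_range_self z
    obtain ⟨f, hf⟩ := h.exists_homeomorph (continuous_flip (x := x) i)
      (fun z => by
        have := (flip_mem_and_flip_flip hx i (hmem z)).1
        rwa [← hc] at this) fun z => (flip_mem_and_flip_flip hx i (hmem z)).2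
    refine ⟨g.trans f, ?_, ?_⟩
    · rw [Homeomorph.trans_apply, hg]
      apply h.injective
      rw [hf, ha, flip_bladePoint hw, he, bladeLength]
    · rw [Homeomorph.trans_apply, hgt]
      apply h.injective
      rw [hf, h.top, ← bladePoint_zero [], flip_bladePoint (reduced_singleton i), shrink_zero,
        bladePoint_zero, bladePoint_zero]

/-- The ends of the blades around the root blade accumulate on it at the cluster points of
their heights. -/
theorem mem_closure_tips (hx : ∀ i, 0 < x i) (hr : ∀ i, x i ≤ r) (hr1 : r < 1)
    (h : IsStarChart c [] t) (hc : range c = wordFan x) {S : Set ℝ} (hS : IsClosed S)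
    (h0 : (0 : ℝ) ∈ S) (hnear : ∀ i, ∃ s ∈ S, |x i - s| ≤ 1 / (i + 1))
    (hdense : ∀ s ∈ S, ∀ N, ∀ ε > 0, ∃ i ≥ N, |x i - s| < ε) {z : X} {s : ℝ} (hs : 0 ≤ s)
    (hz : c z = bladePoint [] s) :
    z ∈ closure {e | ∃ w, w ≠ [] ∧ Reduced w ∧ c e = bladePoint w (bladeLength x w)} ↔ s ∈ S := by
  have hr0 : 0 ≤ r := (hx 0).le.trans (hr 0)
  constructor
  · intro hcl
    by_contra hsS
    obtain ⟨δ, hδ, hball⟩ := Metric.isOpen_iff.1 hS.isOpen_compl s hsS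
    have hfar : ∀ s' ∈ S, δ ≤ |s' - s| := by
      intro s' hs'
      by_contra! hlt
      exact hball (show s' ∈ Metric.ball s δ from hlt) hs'
    -- Here 0 ∈ S is used: tips near `z` have height above δ/2, which rules out the low tips of long
    -- words.
    have hδs : δ ≤ s := by simpa [abs_of_nonneg hs] using hfar 0 h0
    obtain ⟨N₁, hN₁⟩ := exists_nat_one_div_lt (half_pos hδ)
    obtain ⟨N₂, hN₂⟩ := exists_pow_lt_of_lt_one (half_pos hδ) hr1
    let N := max N₁ N₂
    have hopen : IsOpen ({q | |c q [] - s| < δ / 2} ∩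
        ⋂ i ∈ Finset.range N, {q | c q [i] < δ / 2}) :=
      (isOpen_lt (((h.continuous_apply []).sub continuous_const).abs) continuous_const).inter
        (isOpen_biInter_finset fun i _ => isOpen_lt (h.continuous_apply [i]) continuous_const)
    obtain ⟨e, ⟨he1, he2⟩, w, hw0, hw, he⟩ := mem_closure_iff.1 hcl _ hopen
      ⟨by simp [hz, bladePoint_nil, hδ], by simp [hz, bladePoint, hδ]⟩
    rw [mem_ofPred_eq, he, bladePoint_nil] at he1
    simp only [mem_iInter, Finset.mem_range, mem_ofPred_eq] at he2
    obtain ⟨i, v, rfl⟩ := List.exists_cons_of_ne_nil hw0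
    have hlt := (abs_lt.1 he1).1
    -- On a blade starting with `i` the coordinate `[i]` is the full height, which exceeds δ/2; the
    -- neighbourhood forbids this for i < N.
    have hiN : N ≤ i := by
      by_contra! hi
      have := he2 i hi
      simp only [he, bladePoint, List.cons_prefix_cons, List.nil_prefix, and_self, if_true] at this
      linarith
    rcases v with _ | ⟨j, v⟩
    · have hxi : bladeLength x [i] = x i := by simp [bladeLength, shrink]
      rw [hxi] at he1
      obtain ⟨s', hs', hxs⟩ := hnear i
      have h1 : 1 / ((i : ℝ) + 1) ≤ 1 / ((N₁ : ℝ) + 1) := by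
        have : (N₁ : ℝ) ≤ i := by exact_mod_cast (le_max_left _ _).trans hiN
        gcongr
      have h2 : |s' - s| ≤ |x i - s'| + |x i - s| := by
        rw [abs_sub_comm (x i) s']
        exact abs_sub_le _ _ _
      linarith [hfar s' hs']
    · have hv : bladeLength x (j :: v) ≤ r := by
        have h1 := (bladeLength_le_pow hx hr hr1.le (j :: v)).1
        rw [List.length_cons] at h1
        exact h1.trans (pow_le_of_le_one hr0 hr1.le (by omega))
      -- The exponent i + 1 in `shrink` matters here: with a second letter present, the length
      -- decays as the first letter grows.
      have hlen : bladeLength x (i :: j :: v) ≤ r ^ N₂ := by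
        calc bladeLength x (i :: j :: v) = x i * bladeLength x (j :: v) ^ (i + 1) := rfl
          _ ≤ 1 * r ^ (i + 1) := mul_le_mul ((hr i).trans hr1.le)
              (pow_le_pow_left₀ (bladeLength_pos hx _).le hv _)
              (pow_nonneg (bladeLength_pos hx _).le _) zero_le_one
          _ ≤ r ^ N₂ := by
            rw [one_mul]
            exact pow_le_pow_of_le_one hr0 hr1.le
              (((le_max_right _ _).trans hiN).trans (Nat.le_succ i))
      linarith
  · intro hsS
    -- Letters `k n` ≥ n make every coordinate at a nonempty word eventually vanish, so the
    -- one-letter tips converge to the root blade.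
    choose k hkn hk using fun n : ℕ => hdense s hsS n (1 / ((n : ℝ) + 1)) (by positivity)
    have hmem : ∀ n, ∃ e, c e = bladePoint [k n] (x (k n)) := fun n => by
      have : bladePoint [k n] (x (k n)) ∈ wordFan x :=
        ⟨_, _, reduced_singleton _, (hx _).le, by simp [bladeLength, shrink], rfl⟩
      rwa [← hc] at this
    choose e he using hmem
    have hlim : Tendsto e atTop (𝓝 z) := by
      rw [h.isInducing.tendsto_nhds_iff, tendsto_pi_nhds]
      have hxk : Tendsto (fun n => x (k n)) atTop (𝓝 s) := by
        rw [tendsto_iff_dist_tendsto_zero]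
        exact squeeze_zero (fun _ => dist_nonneg) (fun n => (hk n).le)
          tendsto_one_div_add_atTop_nhds_zero_nat
      intro u
      rcases u with _ | ⟨j, u⟩
      · simpa [he, hz, bladePoint_nil, Function.comp_def] using hxk
      · refine tendsto_const_nhds.congr' ?_
        filter_upwards [eventually_gt_atTop j] with n hn
        have hne : j ≠ k n := (hn.trans_le (hkn n)).ne
        simp [hz, he, bladePoint, hne]
    refine mem_closure_of_tendsto hlim (Eventually.of_forall fun n => ?_)
    refine ⟨[k n], by simp, reduced_singleton _, ?_⟩
    rw [he]
    simp [bladeLength, shrink]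

end WordFan

/-- A closed subset of `[0,1)` containing `0` is the cluster set of a positive sequence. -/
theorem exists_seq_cluster {S : Set unitInterval} (hS : IsClosed S) (h0 : (0 : unitInterval) ∈ S)
    (h1 : (1 : unitInterval) ∉ S) :
    ∃ (x : ℕ → ℝ) (r : ℝ), r < 1 ∧ (∀ i, 0 < x i) ∧ (∀ i, x i ≤ r) ∧
      (∀ i, ∃ s ∈ Subtype.val '' S, |x i - s| ≤ 1 / (i + 1)) ∧
      ∀ s ∈ Subtype.val '' S, ∀ N, ∀ ε > 0, ∃ i ≥ N, |x i - s| < ε := by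
  obtain ⟨m, hmS, hm⟩ := hS.isCompact.exists_isGreatest ⟨0, h0⟩
  have hm0 : (0 : ℝ) ≤ m := m.2.1
  have hm1 : (m : ℝ) < 1 := lt_of_le_of_ne m.2.2 fun e =>
    h1 (by rwa [show m = 1 from Subtype.ext e] at hmS)
  have : Nonempty S := ⟨⟨0, h0⟩⟩
  let d := TopologicalSpace.denseSeq S
  have hdm : ∀ n, ((d n : unitInterval) : ℝ) ≤ m := fun n => hm (d n).2
  have hd0 : ∀ n, (0 : ℝ) ≤ (d n : unitInterval) := fun n => (d n : unitInterval).2.1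
  have hfrac : ∀ i : ℕ, 0 < 1 / ((i : ℝ) + 1) ∧ 1 / ((i : ℝ) + 1) ≤ 1 := fun i => by
    refine ⟨by positivity, ?_⟩
    rw [div_le_one (by positivity)]
    linarith [(Nat.cast_nonneg i : (0 : ℝ) ≤ i)]
  have hb0 : 0 < (1 - (m : ℝ)) / 2 := by linarith
  have hb1 : (1 - (m : ℝ)) / 2 ≤ 1 := by linarith
  have hgap : ∀ i : ℕ, 0 < (1 - (m : ℝ)) / 2 * (1 / ((i : ℝ) + 1)) :=
    fun i => mul_pos hb0 (hfrac i).1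
  have hgap' : ∀ i : ℕ, (1 - (m : ℝ)) / 2 * (1 / ((i : ℝ) + 1)) ≤ 1 / ((i : ℝ) + 1) :=
    fun i => mul_le_of_le_one_left (hfrac i).1.le hb1
  -- Unpairing visits each term of the dense sequence infinitely often. The vanishing shift makes
  -- the terms positive and, as m = max S < 1, keeps them below the midpoint of m and 1.
  refine ⟨fun i => (d i.unpair.1 : unitInterval) + (1 - (m : ℝ)) / 2 * (1 / ((i : ℝ) + 1)),
    m + (1 - m) / 2, by linarith, fun i => add_pos_of_nonneg_of_pos (hd0 _) (hgap i),
    fun i => add_le_add (hdm _) (mul_le_of_le_one_right hb0.le (hfrac i).2), fun i => ?_, ?_⟩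
  · refine ⟨_, ⟨_, (d i.unpair.1).2, rfl⟩, ?_⟩
    rw [add_sub_cancel_left, abs_of_pos (hgap i)]
    exact hgap' i
  · rintro _ ⟨s, hs, rfl⟩ N ε hε
    obtain ⟨n, hn⟩ := (TopologicalSpace.denseRange_denseSeq S).exists_dist_lt ⟨s, hs⟩ (half_pos hε)
    obtain ⟨M, hM⟩ := exists_nat_one_div_lt (half_pos hε)
    refine ⟨Nat.pair n (max N M), (le_max_left _ _).trans (Nat.right_le_pair _ _), ?_⟩
    have hle : (M : ℝ) ≤ Nat.pair n (max N M) := by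
      exact_mod_cast (le_max_right _ _).trans (Nat.right_le_pair _ _)
    have h2 : 1 / ((Nat.pair n (max N M) : ℝ) + 1) ≤ 1 / ((M : ℝ) + 1) := by gcongr
    have h3 : |((d n : unitInterval) : ℝ) - s| < ε / 2 := by
      rw [abs_sub_comm]; exact hn
    simp only [Nat.unpair_pair]
    have h4 := abs_lt.1 h3
    have h5 := hgap (Nat.pair n (max N M))
    have h6 := hgap' (Nat.pair n (max N M))
    rw [abs_lt]
    constructor <;> linarith

theorem exists_fan_of_zero_mem {S : Set unitInterval} (hS : IsClosed S)
    (h1 : (1 : unitInterval) ∉ S) (h0 : (0 : unitInterval) ∈ S) :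
    ∃ (F : Type) (_ : MetricSpace F) (t : F), IsFan F t ∧ IsSmooth F t ∧
      EndpointHomogeneous F ∧ IsEndpointGenerated F t S := by
  obtain ⟨x, r, hr1, hx, hr, hnear, hdense⟩ := exists_seq_cluster hS h0 h1
  obtain ⟨X, _, _, c, t, h, hc⟩ := exists_isStarChart (ι := List ℕ) []
    (isCompact_wordFan hx hr hr1)
    ⟨[], 0, reduced_nil, le_rfl, (bladeLength_pos hx _).le, (bladePoint_zero _).symm⟩
    (by rintro _ ⟨w, y, -, hy, -, rfl⟩; rwa [bladePoint_nil])
    (by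
      rintro _ ⟨w, y, -, -, -, rfl⟩ u
      by_cases hu : u <+: w <;> simp [bladePoint, hu])
    (by
      rintro _ ⟨w, y, hw, hy0, hy1, rfl⟩ s hs0 hs1
      exact ⟨w, s * y, hw, mul_nonneg hs0 hy0, (mul_le_of_le_one_left hy0 hs1).trans hy1,
        smul_bladePoint s w y⟩)
  have htip : ∀ w, Reduced w → ∃ e, c e = bladePoint w (bladeLength x w) := fun w hw => by
    have : bladePoint w (bladeLength x w) ∈ wordFan x :=
      ⟨w, _, hw, (bladeLength_pos hx w).le, le_rfl, rfl⟩
    rwa [← hc] at this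
  have hunique : ∀ {w w' e}, c e = bladePoint w (bladeLength x w) →
      c e = bladePoint w' (bladeLength x w') → w = w' := fun h1 h2 =>
    (eq_of_bladePoint_eq (bladeLength_pos hx _).ne' (h1.symm.trans h2)).1
  -- Three distinct reduced words supply three tips, hence a triod at the centre.
  let word : Fin 3 → List ℕ := ![[], [0], [1]]
  have hword : ∀ i, Reduced (word i) := by
    intro i
    fin_cases i
    · exact reduced_nil
    · exact reduced_singleton 0
    · exact reduced_singleton 1
  have hwordi : Function.Injective word := by decide
  choose e he using fun i => htip (word i) (hword i)
  have hei : Function.Injective e := fun i j hij => hwordi (hunique (he i) (hij ▸ he j))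
  have hetip : ∀ i, IsTip c t (e i) := fun i => (isTip_iff hx h hc).2 ⟨_, hword i, he i⟩
  have hends : ∀ {a : X}, a ∈ endpoints X ↔
      ∃ w, Reduced w ∧ c a = bladePoint w (bladeLength x w) := fun {a} =>
    (h.mem_endpoints_iff_isTip (hetip 0) (hetip 1) (hei.ne (by decide))).trans (isTip_iff hx h hc)
  have he₀ : c (e 0) = bladePoint [] 1 := he 0
  have htrans : ∀ a ∈ endpoints X, ∃ g : X ≃ₜ X, g (e 0) = a ∧ g t = t := fun a ha => by
    obtain ⟨w, hw, haw⟩ := hends.1 ha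
    exact exists_homeomorph_tip hx h hc he₀ w hw a haw
  refine ⟨X, inferInstance, t, h.isFan_of_isTip hetip hei, h.isSmooth, ?_, ?_⟩
  · intro a ha b hb
    obtain ⟨g, hg, -⟩ := htrans a ha
    obtain ⟨g', hg', -⟩ := htrans b hb
    exact ⟨g.symm.trans g', by simp [← hg, hg']⟩
  · obtain ⟨φ, hφ⟩ := h.exists_homeomorph_segment (hetip 0).1
    have hφ' : ∀ s : unitInterval, c (φ s) = bladePoint [] s := fun s => by
      rw [hφ, he₀, smul_bladePoint, mul_one]
    refine isEndpointGenerated_of_transitive htrans φ ?_ ?_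
    · apply h.injective
      rw [hφ, h.top]
      simp
    · have hset : endpoints X \ segment t (e 0) =
          {a | ∃ w, w ≠ [] ∧ Reduced w ∧ c a = bladePoint w (bladeLength x w)} := by
        rw [h.segment_top]
        ext a
        constructor
        · rintro ⟨ha, har⟩
          obtain ⟨w, hw, haw⟩ := hends.1 ha
          refine ⟨w, ?_, hw, haw⟩
          rintro rfl
          apply har
          rw [show a = e 0 from h.injective (haw.trans he₀.symm)]
          exact mem_ray_self c _
        · rintro ⟨w, hw0, hw, haw⟩
          refine ⟨hends.2 ⟨w, hw, haw⟩,
            notMem_ray_of_isTip ((isTip_iff hx h hc).2 ⟨w, hw, haw⟩) ?_⟩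
          rintro rfl
          exact hw0 (hunique haw (he 0))
      have hcl := fun s : unitInterval => mem_closure_tips hx hr hr1 h hc
        (hS.isCompact.image continuous_subtype_val).isClosed ⟨0, h0, rfl⟩ hnear hdense s.2.1 (hφ' s)
      rw [hset]
      ext z
      constructor
      · rintro ⟨s, hs, rfl⟩
        exact ⟨(φ s).2, (hcl s).2 ⟨s, hs, rfl⟩⟩
      · rintro ⟨hz, hzc⟩
        have hzφ : (φ (φ.symm ⟨z, hz⟩) : X) = z := by simp
        rw [← hzφ, hcl] at hzc
        obtain ⟨s, hs, hse⟩ := hzc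
        exact ⟨s, hs, by rw [Subtype.ext hse]; exact hzφ⟩

end EPGFan

namespace EPGFan

/-! ### The empty case: three segments. -/

section Tripod

/-- The point at height `y` on the `k`-th leg of the tripod. -/
def legPoint (k : Fin 3) (y : ℝ) : Option (Fin 3) → ℝ := fun u =>
  if u.all (· = k) then y else 0

theorem legPoint_none (k : Fin 3) (y : ℝ) : legPoint k y none = y := by simp [legPoint]

theorem smul_legPoint (s : ℝ) (k : Fin 3) (y : ℝ) :
    s • legPoint k y = legPoint k (s * y) := by
  ext u; simp [legPoint]

theorem legPoint_comp_map (σ : Equiv.Perm (Fin 3)) (k : Fin 3) (y : ℝ) :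
    legPoint k y ∘ Option.map σ = legPoint (σ.symm k) y := by
  ext u
  rcases u with _ | j
  · simp [legPoint]
  · simp [legPoint, Equiv.eq_symm_apply]

theorem eq_of_legPoint_eq {k k' : Fin 3} {y y' : ℝ} (hy : y ≠ 0)
    (h : legPoint k y = legPoint k' y') : k = k' ∧ y = y' := by
  have h1 := congrFun h none
  have h2 := congrFun h (some k)
  simp only [legPoint_none] at h1
  subst h1
  refine ⟨?_, rfl⟩
  by_contra hk
  simp [legPoint, hk, hy] at h2

theorem exists_fan_empty : ∃ (F : Type) (_ : MetricSpace F) (t : F), IsFan F t ∧ IsSmooth F t ∧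
    EndpointHomogeneous F ∧ IsEndpointGenerated F t ∅ := by
  obtain ⟨X, _, _, c, t, h, hc⟩ := exists_isStarChart (ι := Option (Fin 3)) none
    (F := ⋃ k, legPoint k '' Icc 0 1)
    (isCompact_iUnion fun k => isCompact_Icc.image (continuous_pi fun u => by
      unfold legPoint
      split_ifs <;> fun_prop))
    (mem_iUnion.2 ⟨0, 0, ⟨le_rfl, zero_le_one⟩, by ext u; simp [legPoint]⟩)
    (by
      intro p hp
      obtain ⟨k, y, hy, rfl⟩ := mem_iUnion.1 hp
      rw [legPoint_none]
      exact hy.1)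
    (by
      intro p hp u
      obtain ⟨k, y, hy, rfl⟩ := mem_iUnion.1 hp
      rw [legPoint_none, legPoint]
      split_ifs <;> simp)
    (by
      intro p hp s hs0 hs1
      obtain ⟨k, y, hy, rfl⟩ := mem_iUnion.1 hp
      exact mem_iUnion.2 ⟨k, s * y, ⟨mul_nonneg hs0 hy.1, mul_le_one₀ hs1 hy.1 hy.2⟩,
        (smul_legPoint s k y).symm⟩)
  have hmem : ∀ a, ∃ k y, 0 ≤ y ∧ y ≤ 1 ∧ c a = legPoint k y := fun a => by
    obtain ⟨k, y, hy, e⟩ := mem_iUnion.1 (hc ▸ mem_range_self a)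
    exact ⟨k, y, hy.1, hy.2, e.symm⟩
  have hex : ∀ k y, 0 ≤ y → y ≤ 1 → ∃ a, c a = legPoint k y := fun k y h0 h1 => by
    have : legPoint k y ∈ range c := hc ▸ mem_iUnion.2 ⟨k, y, ⟨h0, h1⟩, rfl⟩
    exact this
  choose e he using fun k => hex k 1 zero_le_one le_rfl
  have hray : ∀ {a k y}, 0 ≤ y → y ≤ 1 → c a = legPoint k y → a ∈ ray c (e k) :=
    fun h0 h1 ha => ⟨_, h0, h1, by rw [he, smul_legPoint, mul_one, ha]⟩
  have hetip : ∀ k, IsTip c t (e k) := fun k => by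
    refine ⟨fun het => ?_, ?_⟩
    · rw [h.eq_top_iff, he, legPoint_none] at het
      exact one_ne_zero het
    · rintro a ⟨s, h0, h1, hs⟩
      obtain ⟨k', y, hy0, hy1, ha⟩ := hmem a
      rw [he, ha, smul_legPoint] at hs
      obtain ⟨rfl, hy⟩ := eq_of_legPoint_eq one_ne_zero hs
      have : y = 1 := le_antisymm hy1 (hy.le.trans (mul_le_of_le_one_left hy0 h1))
      exact h.injective (by rw [ha, he, this])
  have hei : Function.Injective e := fun k k' hk =>
    (eq_of_legPoint_eq one_ne_zero ((he k).symm.trans (hk ▸ he k'))).1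
  have hends : endpoints X = range e := by
    ext a
    rw [h.mem_endpoints_iff_isTip (hetip 0) (hetip 1) (hei.ne (by decide))]
    constructor
    · rintro ⟨-, ha⟩
      obtain ⟨k, y, h0, h1, hk⟩ := hmem a
      exact ⟨k, ha _ (hray h0 h1 hk)⟩
    · rintro ⟨k, rfl⟩
      exact hetip k
  have htrans : ∀ k k', ∃ g : X ≃ₜ X, g (e k) = e k' := by
    intro k k'
    -- Permuting the leg coordinates permutes the legs; a transposition gives the required
    -- involution.
    obtain ⟨g, hg⟩ := h.exists_homeomorph (H := fun p => p ∘ Option.map (Equiv.swap k k'))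
      (continuous_pi fun u => continuous_apply _)
      (fun a => by
        obtain ⟨j, y, h0, h1, ha⟩ := hmem a
        rw [ha, legPoint_comp_map]
        exact hex _ y h0 h1)
      (fun a => by
        ext u
        rcases u with _ | j <;> simp)
    refine ⟨g, h.injective ?_⟩
    rw [hg, he, legPoint_comp_map, he]
    simp
  refine ⟨X, inferInstance, t, h.isFan_of_isTip hetip hei, h.isSmooth, ?_, ?_⟩
  · intro a ha b hb
    rw [hends] at ha hb
    obtain ⟨k, rfl⟩ := ha
    obtain ⟨k', rfl⟩ := hb
    exact htrans k k'
  · rintro _ ⟨a, ha, rfl⟩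
    have hat : a ≠ t := by
      obtain ⟨k, rfl⟩ := hends ▸ ha
      exact (hetip k).1
    obtain ⟨φ, hφ⟩ := h.exists_homeomorph_segment hat
    refine ⟨φ, h.injective (by rw [hφ, h.top]; simp), ?_⟩
    -- A finite set is closed, so the other endpoints have no limit on the blade.
    have hfin : (endpoints X \ segment t a).Finite := by
      rw [hends]
      exact (finite_range e).sdiff
    rw [image_empty, hfin.isClosed.closure_eq, inter_sdiff_self]

end Tripod

end EPGFan

theorem mainTheorem4 (S : Set unitInterval) (hS : IsClosed S) (h1 : (1 : unitInterval) ∉ S)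
    (h0 : S = ∅ ∨ (0 : unitInterval) ∈ S) :
    ∃ (F : Type) (_ : MetricSpace F) (t : F),
      EPGFan.IsFan F t ∧ EPGFan.IsSmooth F t ∧ EPGFan.EndpointHomogeneous F ∧
        EPGFan.IsEndpointGenerated F t S := by
  rcases h0 with rfl | h0
  · exact EPGFan.exists_fan_empty
  · exact EPGFan.exists_fan_of_zero_mem hS h1 h0
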